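/- Let $q\ge 2$, $\Sigma=\{0,1,\dots,q-1\}$, and let $\mathcal F$ be a finite collection of words over $\Sigma$, each of length at least $2$. Let $\Sigma_{\mathcal F}\subset\Sigma^{\mathbb N}$ be the subshift of finite type consisting of all one-sided sequences in which no word of $\mathcal F$ occurs; call a word *allowed* if it occurs in some sequence of $\Sigma_{\mathcal F}$. Assume that $\mathcal F$ is *minimal*: every proper subword of a word of $\mathcal F$ is allowed. Let $p$ be the length of the longest word of $\mathcal F$ ($p=2$ if $\mathcal F=\emptyset$). The *adjacency matrix* $A$ of $\Sigma_{\mathcal F}$ is the $(0,1)$-matrix indexed by the allowed words of length $p-1$ whose entry at $(x_1\cdots x_{p-1},\,y_1\cdots y_{p-1})$ is $1$ if and only if $x_2\cdots x_{p-1}=y_1\cdots y_{p-2}$ and $x_1\cdots x_{p-1}y_{p-1}$ is allowed. Let $\theta$ be the Perron root of $A$, that is, its spectral radius. Call $\Sigma_{\mathcal F}$ *irreducible* if for all indices $x,y$ there is $\ell\ge1$ with $(A^\ell)_{xy}>0$. Let $f(n)$ be the number of words of length $n$ over $\Sigma$ that contain no word of $\mathcal F$ as a subword. For words $x,y$ of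 lengths $p_1,p_2$ let $(x,y)_z=\sum_{\ell=0}^{p_1-1}b_\ell z^{p_1-1-\ell}$, where $b_\ell=1$ if the overlapping parts of $x$ and $y$ agree when the first symbol of $y$ is placed below the $(\ell+1)$-th symbol of $x$, and $b_\ell=0$ otherwise. Write $\mathcal F=\{a_1,\dots,a_s\}$, let $\mathcal M(z)=\big((a_j,a_i)_z\big)_{1\le i,j\le s}$, and let $r(z)$ be the sum of the entries of $\mathcal M(z)^{-1}$. Then: 1. There is a rational function $F$ with $F(z)=\sum_{n\ge0}f(n)z^{-n}$ (a convergent series) for all complex $z$ with $|z|>\theta$. It is analytic on $\{|z|>\theta\}$, and $\theta$ is a pole of $F$. If $\Sigma_{\mathcal F}$ is irreducible, this pole is simple. 2. $\det\mathcal M(z)$ is not the zero polynomial, so $r$ is a well-defined rational function, and $\theta$ is the largest real zero of the rational function $(z-q)+r(z)$. Moreover every complex zero of $(z-q)+r(z)$ has modulus at most $\theta$, and if $\Sigma_{\mathcal F}$ is irreducible, $\theta$ is a simple zero. (Zeros, poles and their orders are those of the rational function in lowest terms.) -/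

import Mathlib

namespace SFT

noncomputable section

open scoped Classical

/-- The word `w` occurs (as a block of consecutive symbols) in the one-sided sequence `s`. -/
def OccursIn {q : ℕ} (w : List (Fin q)) (s : ℕ → Fin q) : Prop :=
  ∃ k : ℕ, w = (List.range w.length).map (fun i => s (k + i))

/-- The subshift of finite type `Σ_F`: all one-sided sequences over the symbols `0, …, q - 1`
in which no word of the finite collection `F` occurs. -/
def subshift {q : ℕ} (F : Finset (List (Fin q))) : Set (ℕ → Fin q) :=
  {s | ∀ a ∈ F, ¬ OccursIn a s}

/-- A word is allowed in `Σ_F` if it occurs in some sequence belonging to `Σ_F`. -/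
def IsAllowed {q : ℕ} (F : Finset (List (Fin q))) (w : List (Fin q)) : Prop :=
  ∃ s ∈ subshift F, OccursIn w s

/-- The forbidden collection `F` is minimal: every proper subword of a word of `F` is allowed
in `Σ_F`. -/
def IsMinimal {q : ℕ} (F : Finset (List (Fin q))) : Prop :=
  ∀ a ∈ F, ∀ w : List (Fin q), w <:+: a → w ≠ a → IsAllowed F w

/-- `f(n)`: the number of words of length `n` over `0, …, q - 1` that do not contain any word
of `F` as a subword. -/
def wordCount {q : ℕ} (F : Finset (List (Fin q))) (n : ℕ) : ℕ :=
  Nat.card {w : Fin n → Fin q // ∀ a ∈ F, ¬ a <:+: List.ofFn w}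

/-- `p`: the length of the longest word of `F`. When all words of `F` have length at least two,
the maximum with `2` matters only for `F = ∅` (the full shift, which is its own one-step
shift, so `p = 2`). -/
def maxLength {q : ℕ} (F : Finset (List (Fin q))) : ℕ :=
  max 2 (F.sup List.length)

/-- The allowed words of length `p - 1`, which index the adjacency matrix. -/
abbrev State {q : ℕ} (F : Finset (List (Fin q))) : Type :=
  {w : Fin (maxLength F - 1) → Fin q // IsAllowed F (List.ofFn w)}

/-- The adjacency matrix of `Σ_F`: the entry at `(x₁…x_{p-1}, y₁…y_{p-1})` is `1` if
`x₂…x_{p-1} = y₁…y_{p-2}` and `x₁…x_{p-1}y_{p-1}` is an allowed word (of length `p`),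
and `0` otherwise. -/
def adjacencyMatrix {q : ℕ} (F : Finset (List (Fin q))) : Matrix (State F) (State F) ℝ :=
  Matrix.of fun x y =>
    if (List.ofFn x.1).tail = (List.ofFn y.1).dropLast ∧
        IsAllowed F (List.ofFn x.1 ++ (List.ofFn y.1).drop (maxLength F - 2))
    then 1 else 0

/-- `Σ_F` is irreducible if its adjacency matrix is: for all `x, y` some power `A ^ ℓ`, `ℓ ≥ 1`,
has a positive `(x, y)` entry. -/
def IsIrreducible {q : ℕ} (F : Finset (List (Fin q))) : Prop :=
  ∀ x y : State F, ∃ l : ℕ, 1 ≤ l ∧ 0 < (adjacencyMatrix F ^ l) x y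

/-- The Perron root of `Σ_F`: the spectral radius of its adjacency matrix (the largest modulus
of a complex eigenvalue). -/
def perronRoot {q : ℕ} (F : Finset (List (Fin q))) : ℝ :=
  (spectralRadius ℂ ((adjacencyMatrix F).map (fun t : ℝ => (t : ℂ)))).toReal

/-- The correlation polynomial `(x, y)_z = ∑_{ℓ < |x|} b_ℓ z ^ (|x| - 1 - ℓ)`, where `b_ℓ = 1` if
the overlapping parts of `x` and `y` agree when the first symbol of `y` is placed below the
`(ℓ + 1)`-th symbol of `x` (so one of `x_{ℓ+1} x_{ℓ+2} …` and `y` is a prefix of the other),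
and `b_ℓ = 0` otherwise. -/
def corr {q : ℕ} (x y : List (Fin q)) : Polynomial ℂ :=
  ∑ l ∈ Finset.range x.length,
    if x.drop l <+: y ∨ y <+: x.drop l then Polynomial.X ^ (x.length - 1 - l) else 0

/-- The correlation matrix `M(z)` with `(i, j)` entry `(a_j, a_i)_z`, over the field of rational
functions. -/
def corrMatrix {q : ℕ} (F : Finset (List (Fin q))) : Matrix F F (RatFunc ℂ) :=
  Matrix.of fun i j => algebraMap (Polynomial ℂ) (RatFunc ℂ) (corr j.1 i.1)

/-- `r(z)`: the sum of the entries of the inverse of the correlation matrix. -/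
def corrSum {q : ℕ} (F : Finset (List (Fin q))) : RatFunc ℂ :=
  ∑ i : F, ∑ j : F, (corrMatrix F)⁻¹ i j

/-- The rational function `(z - q) + r(z)`. -/
def charFun {q : ℕ} (F : Finset (List (Fin q))) : RatFunc ℂ :=
  (RatFunc.X - RatFunc.C (q : ℂ)) + corrSum F

/-- A rational function as a function on `ℂ`, evaluated in lowest terms. -/
def toFun (g : RatFunc ℂ) (z : ℂ) : ℂ :=
  g.eval (RingHom.id ℂ) z

/-- The order of a rational function at a point: positive at a zero, negative at a pole,
`⊤` for the zero function. -/
def orderAt (g : RatFunc ℂ) (z : ℂ) : WithTop ℤ :=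
  meromorphicOrderAt (toFun g) z

end

end SFT

/-! Let `f(n)` count the avoiding words, and for `a ∈ F` let `e_a(n)` count the words of length `n`
that end in `a` and avoid `F` once the last symbol is deleted. Write `W` and `E_a` for their
generating functions in `1/z`.

Two bijections relate them (Guibas–Odlyzko). Appending a symbol to an avoiding word gives either an
avoiding word or a first occurrence of exactly one forbidden word (`card_words_mul`), so `(z - q) W
+ z ∑ E_a = z`. Appending a forbidden word `b` and stopping at the first completed forbidden word
(`card_words_eq`) gives `W = ∑ (a,b)_z · z E_a` for each `b`. This is a linear system with matrix
`M(z)`. Eliminating the `E_a` by the adjugate yields `W · P = z · det M`, where `P = (z - q) det M +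
∑ adj M` (`wordGen_mul_charNum`). Hence `W` is rational and its product with `(z - q) + r(z)` is
`z`: away from `0`, zeros of the latter are poles of `W` with the same order.

It remains to locate the poles of `W`. By minimality a word is allowed exactly when it avoids `F`
(`isAllowed_iff`), so `f(p - 1 + m)` is the sum of the entries of `A ^ m` (`wordCount_eq_sum_pow`).
Gelfand's formula bounds `f(n)` by `C t ^ n` for each `t > θ`, which gives convergence outside the
disc of radius `θ`. The bound `θ ^ m ≤ f(p - 1 + m)` forces `W` to blow up at `θ`. In the
irreducible case `f(n) ≤ C θ ^ n`, so the blow-up has order one. -/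

namespace SFT

noncomputable section

open scoped Classical
open Finset

variable {q : ℕ} {F : Finset (List (Fin q))}

/-! ### Avoiding words are exactly the allowed words -/

/-- The word `l` contains no word of `F`. -/
def Avoids (F : Finset (List (Fin q))) (l : List (Fin q)) : Prop :=
  ∀ a ∈ F, ¬ a <:+: l

theorem Avoids.mono {l l' : List (Fin q)} (h : Avoids F l) (hl : l' <:+: l) : Avoids F l' :=
  fun a ha hal => h a ha (hal.trans hl)

theorem OccursIn.mono {l l' : List (Fin q)} {s : ℕ → Fin q} (h : OccursIn l s)
    (hl : l' <:+: l) : OccursIn l' s := by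
  obtain ⟨k, hk⟩ := h
  obtain ⟨u, v, rfl⟩ := hl
  refine ⟨k + u.length, ?_⟩
  apply List.ext_getElem (by simp)
  intro i h1 h2
  have h3 := congrArg (fun t => t[u.length + i]?) hk
  simp only [List.length_append, List.append_assoc] at h3
  rw [List.getElem?_append_right (by omega), List.getElem?_append_left (by omega),
    List.getElem?_eq_getElem (by omega), List.getElem?_eq_getElem (by simp; omega)] at h3
  simpa [add_assoc] using h3

theorem IsAllowed.avoids {l : List (Fin q)} (h : IsAllowed F l) : Avoids F l := by
  obtain ⟨s, hs, hl⟩ := h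
  exact fun a ha hal => hs a ha (hl.mono hal)

/-- Minimality makes `F` an antichain for the subword order, since a proper subword of a forbidden
word is allowed and so cannot itself be forbidden. -/
theorem eq_of_infix (hmin : IsMinimal F) {a b : List (Fin q)} (ha : a ∈ F) (hb : b ∈ F)
    (hab : a <:+: b) : a = b := by
  by_contra hne
  exact (hmin b hb a hab hne).avoids a ha List.infix_rfl

theorem suffix_of_infix_concat {a l : List (Fin q)} {c : Fin q} (h : a <:+: l ++ [c])
    (h' : ¬ a <:+: l) : a <:+ l ++ [c] := by
  rcases List.infix_concat_iff.1 h with h | h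
  · exact h
  · exact absurd h h'

/-- If every symbol `c` completed a forbidden word `a c`, take the longest of them. Without its last
symbol it is allowed by minimality, so some symbol `c'` follows it harmlessly; but the suffix `a c'`
is no longer than `a c` and therefore fits inside this harmless word. -/
theorem Avoids.exists_concat (hq : 0 < q) (hmin : IsMinimal F) (hlen : ∀ a ∈ F, 2 ≤ a.length)
    {l : List (Fin q)} (h : Avoids F l) : ∃ c, Avoids F (l ++ [c]) := by
  by_contra hcon
  have hc : ∀ c, ∃ a ∈ F, a <:+ l ++ [c] := by
    intro c
    by_contra hno
    refine hcon ⟨c, fun a ha hal => hno ⟨a, ha, suffix_of_infix_concat hal (h a ha)⟩⟩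
  choose a ha hal using hc
  have : Nonempty (Fin q) := ⟨⟨0, hq⟩⟩
  obtain ⟨c, hcmax⟩ := Finite.exists_max fun c => (a c).length
  have hne : a c ≠ [] := by
    intro h0
    have := hlen _ (ha c)
    simp [h0] at this
  have hallow : IsAllowed F (a c).dropLast := by
    refine hmin _ (ha c) _ (List.dropLast_prefix _).isInfix fun h0 => ?_
    have := congrArg List.length h0
    have := hlen _ (ha c)
    simp at *
    omega
  obtain ⟨s, hs, k, hk⟩ := hallow
  set c' := s (k + (a c).dropLast.length) with hc'
  have hav : Avoids F ((a c).dropLast ++ [c']) := by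
    refine IsAllowed.avoids ⟨s, hs, k, ?_⟩
    rw [List.length_append, List.length_singleton, List.range_succ, List.map_append, ← hk]
    simp [hc']
  have hsuf : (a c).dropLast ++ [c'] <:+ l ++ [c'] := by
    obtain ⟨t, ht⟩ := hal c
    refine ⟨t, ?_⟩
    rw [← List.append_assoc]
    congr 1
    have := congrArg List.dropLast ht
    rwa [List.dropLast_append_of_ne_nil hne, List.dropLast_concat] at this
  refine hav _ (ha c') (List.suffix_of_suffix_length_le (hal c') hsuf ?_).isInfix
  have := hcmax c'
  have := List.length_pos_of_ne_nil hne
  simp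
  omega

/-- Extending one symbol at a time forever produces a sequence that starts with `l`; any occurrence
of a forbidden word in it would lie in a finite stage. -/
theorem Avoids.isAllowed (hq : 0 < q) (hmin : IsMinimal F) (hlen : ∀ a ∈ F, 2 ≤ a.length)
    {l : List (Fin q)} (h : Avoids F l) : IsAllowed F l := by
  choose ext hext using fun w : {w // Avoids F w} => w.2.exists_concat hq hmin hlen
  obtain ⟨W, hW0, hW⟩ : ∃ W : ℕ → {w // Avoids F w}, (W 0).1 = l ∧
      ∀ n, (W (n + 1)).1 = (W n).1 ++ [ext (W n)] :=
    ⟨fun n => Nat.rec ⟨l, h⟩ (fun _ w => ⟨w.1 ++ [ext w], hext w⟩) n, rfl, fun n => rfl⟩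
  have hWlen : ∀ n, (W n).1.length = l.length + n := by
    intro n
    induction n with
    | zero => rw [hW0]; rfl
    | succ n ih => rw [hW, List.length_append, ih]; simp [add_assoc]
  have hpre : ∀ n m, n ≤ m → (W n).1 <+: (W m).1 := by
    intro n m hnm
    induction m, hnm using Nat.le_induction with
    | base => exact List.prefix_rfl
    | succ m _ ih => exact ih.trans (by rw [hW]; exact List.prefix_append _ _)
  -- Stage `i + 1` has length at least `i + 1`, so position `i` exists there and the default value
  -- is never read.
  let s : ℕ → Fin q := fun i => (W (i + 1)).1.getD i ⟨0, hq⟩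
  have hs : ∀ n, (W n).1 = (List.range (W n).1.length).map s := by
    intro n
    apply List.ext_getElem (by simp)
    intro i h1 h2
    have hi : i < (W (i + 1)).1.length := by rw [hWlen]; omega
    simp only [List.getElem_map, List.getElem_range, s]
    rw [List.getD_eq_getElem _ _ hi]
    rcases le_total n (i + 1) with hn | hn
    · exact (hpre _ _ hn).getElem h1
    · exact ((hpre _ _ hn).getElem hi).symm
  refine ⟨s, ?_, 0, by simpa [hW0] using hs 0⟩
  rintro a ha ⟨k, hk⟩
  refine (W (k + a.length)).2 a ha ?_
  rw [hs, hWlen, show l.length + (k + a.length) = k + (a.length + l.length) by omega,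
    List.range_add, List.range_add, List.map_append, List.map_append, List.map_append]
  have hk' : a = ((List.range a.length).map fun x => k + x).map s := by
    rw [List.map_map]; exact hk
  rw [← hk', ← List.append_assoc]
  exact ⟨_, _, rfl⟩

theorem isAllowed_iff (hq : 0 < q) (hmin : IsMinimal F) (hlen : ∀ a ∈ F, 2 ≤ a.length)
    {l : List (Fin q)} : IsAllowed F l ↔ Avoids F l :=
  ⟨IsAllowed.avoids, Avoids.isAllowed hq hmin hlen⟩

theorem avoids_nil (hlen : ∀ a ∈ F, 2 ≤ a.length) : Avoids F [] := by
  intro a ha h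
  have := hlen a ha
  simp [List.infix_nil.1 h] at this

/-! ### The two counting identities -/

/-- All words of length `n`. -/
def allWords (q n : ℕ) : Finset (List (Fin q)) :=
  (univ : Finset (Fin n → Fin q)).image List.ofFn

@[simp] theorem mem_allWords {n : ℕ} {l : List (Fin q)} : l ∈ allWords q n ↔ l.length = n := by
  simp only [allWords, mem_image, mem_univ, true_and]
  constructor
  · rintro ⟨w, rfl⟩; simp
  · rintro rfl; exact ⟨l.get, List.ofFn_get l⟩

/-- The words of length `n` that avoid `F`. -/
def words (F : Finset (List (Fin q))) (n : ℕ) : Finset (List (Fin q)) :=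
  (allWords q n).filter (Avoids F)

@[simp] theorem mem_words {n : ℕ} {l : List (Fin q)} :
    l ∈ words F n ↔ l.length = n ∧ Avoids F l := by
  simp [words]

/-- The words of length `n` ending in `a` that become `F`-avoiding when the last symbol is
deleted. -/
def endWords (F : Finset (List (Fin q))) (a : List (Fin q)) (n : ℕ) : Finset (List (Fin q)) :=
  (allWords q n).filter fun l => a <:+ l ∧ Avoids F l.dropLast

@[simp] theorem mem_endWords {n : ℕ} {a l : List (Fin q)} :
    l ∈ endWords F a n ↔ l.length = n ∧ a <:+ l ∧ Avoids F l.dropLast := by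
  simp [endWords]

theorem wordCount_eq (n : ℕ) : wordCount F n = (words F n).card := by
  rw [wordCount, Nat.card_eq_fintype_card, Fintype.card_subtype, words, allWords,
    filter_image, card_image_of_injective _ List.ofFn_injective]
  congr!

theorem endWords_eq_empty {n : ℕ} {a : List (Fin q)} (h : n < a.length) :
    endWords F a n = ∅ := by
  ext l
  simp only [mem_endWords, notMem_empty, iff_false, not_and]
  rintro rfl hs
  exact absurd hs.length_le (by omega)

theorem exists_suffix_of_not_avoids {l : List (Fin q)} (h : ¬ Avoids F l)
    (h' : Avoids F l.dropLast) : ∃ a ∈ F, a <:+ l := by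
  rcases List.eq_nil_or_concat l with rfl | ⟨l, c, rfl⟩
  · exact absurd h' h
  · rw [List.concat_eq_append] at *
    rw [List.dropLast_concat] at h'
    simp only [Avoids, not_forall, not_not] at h
    obtain ⟨a, ha, hal⟩ := h
    exact ⟨a, ha, suffix_of_infix_concat hal (h' a ha)⟩

theorem eq_of_suffix (hmin : IsMinimal F) {a b l : List (Fin q)} (ha : a ∈ F) (hb : b ∈ F)
    (hal : a <:+ l) (hbl : b <:+ l) : a = b := by
  rcases List.suffix_or_suffix_of_suffix hal hbl with h | h
  · exact eq_of_infix hmin ha hb h.isInfix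
  · exact (eq_of_infix hmin hb ha h.isInfix).symm

/-- Appending a symbol to an avoiding word. -/
theorem card_words_mul (hmin : IsMinimal F) (n : ℕ) :
    q * (words F n).card = (words F (n + 1)).card + ∑ a ∈ F, (endWords F a (n + 1)).card := by
  have h1 : q * (words F n).card =
      ((allWords q (n + 1)).filter fun l => Avoids F l.dropLast).card := by
    rw [mul_comm]
    trans (words F n ×ˢ (univ : Finset (Fin q))).card
    · rw [card_product, card_univ, Fintype.card_fin]
    refine card_bij (fun x _ => x.1 ++ [x.2]) ?_ ?_ ?_
    · rintro ⟨l, c⟩ h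
      simpa using h
    · rintro ⟨l, c⟩ _ ⟨l', c'⟩ _ h
      simpa using h
    · intro l hl
      rcases List.eq_nil_or_concat l with rfl | ⟨l, c, rfl⟩
      · simp at hl
      · exact ⟨(l, c), by simpa using hl, by simp⟩
  rw [h1, ← card_biUnion, ← card_union_of_disjoint]
  · congr 1
    ext l
    simp only [mem_filter, mem_allWords, mem_union, mem_words, mem_biUnion, mem_endWords]
    constructor
    · rintro ⟨hl, hav⟩
      by_cases h : Avoids F l
      · exact Or.inl ⟨hl, h⟩
      · obtain ⟨a, ha, hal⟩ := exists_suffix_of_not_avoids h hav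
        exact Or.inr ⟨a, ha, hl, hal, hav⟩
    · rintro (⟨hl, h⟩ | ⟨a, _, hl, _, hav⟩)
      · exact ⟨hl, h.mono (List.dropLast_prefix l).isInfix⟩
      · exact ⟨hl, hav⟩
  · rw [disjoint_left]
    intro l hl hl'
    simp only [mem_words, mem_biUnion, mem_endWords] at hl hl'
    obtain ⟨a, ha, _, hal, _⟩ := hl'
    exact hl.2 a ha hal.isInfix
  · intro a ha b hb hab
    rw [Function.onFun, disjoint_left]
    intro l hl hl'
    simp only [mem_endWords] at hl hl'
    exact hab (eq_of_suffix hmin ha hb hl.2.1 hl'.2.1)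

/-- The positions `l` at which `a`, shifted by `l`, overlaps `b`. -/
def overlaps (a b : List (Fin q)) : Finset ℕ :=
  (Finset.range a.length).filter fun l => a.drop l <+: b ∨ b <+: a.drop l

/-- The other alternative, `b` lying inside `a`, collapses to `a = b` and `l = 0` because `F` is an
antichain. -/
theorem drop_prefix_of_mem_overlaps (hmin : IsMinimal F) {a b : List (Fin q)} (ha : a ∈ F)
    (hb : b ∈ F) {l : ℕ} (hl : l ∈ overlaps a b) : a.drop l <+: b := by
  simp only [overlaps, mem_filter, mem_range] at hl
  rcases hl.2 with h | h
  · exact h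
  · have hab := eq_of_infix hmin hb ha (h.isInfix.trans (List.drop_suffix l a).isInfix)
    subst hab
    have := h.length_le
    simp only [List.length_drop] at this
    obtain rfl : l = 0 := by omega
    simp

/-- Appending a forbidden word to an avoiding word. -/
theorem card_words_eq (hmin : IsMinimal F) {b : List (Fin q)} (hb : b ∈ F) (n : ℕ) :
    (words F n).card =
      ∑ a ∈ F, ∑ l ∈ overlaps a b, (endWords F a (n + (a.length - l))).card := by
  simp_rw [← card_sigma]
  symm
  -- The last `a.length - l` symbols of `v` form a suffix of `a` which is a prefix of `b`; hence `v`
  -- is its first `n` symbols followed by a piece of `b`.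
  have key : ∀ a ∈ F, ∀ l ∈ overlaps a b, ∀ v ∈ endWords F a (n + (a.length - l)),
      v = v.take n ++ b.take (a.length - l) := by
    intro a ha l hl v hv
    have hpre := drop_prefix_of_mem_overlaps hmin ha hb hl
    have hl' : l < a.length := by
      simp only [overlaps, mem_filter, mem_range] at hl
      exact hl.1
    rw [mem_endWords] at hv
    have h1 : v.drop n = a.drop l := by
      refine List.IsSuffix.eq_of_length
        (List.suffix_of_suffix_length_le (List.drop_suffix n v)
          ((List.drop_suffix l a).trans hv.2.1) ?_) ?_ <;> simp [hv.1]
    have h2 : b.take (a.length - l) = a.drop l := by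
      have := List.prefix_iff_eq_take.1 hpre
      rw [this, List.length_drop]
    rw [h2, ← h1, List.take_append_drop]
  refine card_bij (fun x _ => x.2.2.take n) ?_ ?_ ?_
  · rintro ⟨a, l, v⟩ h
    simp only [mem_sigma] at h
    obtain ⟨ha, hl, hv⟩ := h
    have hl' : l < a.length := by
      simp only [overlaps, mem_filter, mem_range] at hl
      exact hl.1
    rw [mem_endWords] at hv
    rw [mem_words]
    refine ⟨by simp [hv.1], hv.2.2.mono ?_⟩
    rw [List.dropLast_eq_take]
    exact (List.take_prefix_take_left (by omega)).isInfix
  · rintro ⟨a, l, v⟩ h ⟨a', l', v'⟩ h' heq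
    simp only [mem_sigma] at h h' heq
    obtain ⟨ha, hl, hv⟩ := h
    obtain ⟨ha', hl', hv'⟩ := h'
    have e := key a ha l hl v hv
    have e' := key a' ha' l' hl' v' hv'
    -- For injectivity: of two stopping points after the same word, the earlier already contains a
    -- forbidden word that survives deleting the last symbol of the later.
    have hlt : ∀ {a l v a' l' v'}, a ∈ F → v ∈ endWords F a (n + (a.length - l)) →
        v' ∈ endWords F a' (n + (a'.length - l')) → v.take n = v'.take n →
        v = v.take n ++ b.take (a.length - l) → v' = v'.take n ++ b.take (a'.length - l') →
        ¬ (a.length - l < a'.length - l') := by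
      intro a l v a' l' v' ha hv hv' heq e e' hlt
      rw [mem_endWords] at hv hv'
      refine hv'.2.2 a ha (hv.2.1.isInfix.trans (List.IsPrefix.isInfix ?_))
      have hp : v <+: v' := by
        rw [e, e', heq, List.prefix_append_right_inj]
        exact List.take_prefix_take_left hlt.le
      refine List.prefix_of_prefix_length_le hp (List.dropLast_prefix v') ?_
      simp
      omega
    have hll : a.length - l = a'.length - l' :=
      le_antisymm (not_lt.1 (hlt ha' hv' hv heq.symm e' e)) (not_lt.1 (hlt ha hv hv' heq e e'))
    have hvv : v = v' := by rw [e, e', heq, hll]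
    subst hvv
    rw [mem_endWords] at hv hv'
    have haa := eq_of_suffix hmin ha ha' hv.2.1 hv'.2.1
    subst haa
    simp only [overlaps, mem_filter, mem_range] at hl hl'
    have : l = l' := by omega
    subst this
    rfl
  · intro w hw
    rw [mem_words] at hw
    -- For surjectivity: feed in `b` symbol by symbol and stop at the first `t` where a forbidden
    -- word `a` appears. It ends at the stopping point, and its overlap position is `a.length - t`.
    have hex : ∃ t, ¬ Avoids F (w ++ b.take t) :=
      ⟨b.length, fun h => h b hb (by rw [List.take_length]; exact (List.suffix_append _ _).isInfix)⟩
    set t := Nat.find hex with ht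
    have hbad := Nat.find_spec hex
    rw [← ht] at hbad
    have ht0 : 0 < t := by
      rcases Nat.eq_zero_or_pos t with h | h
      · rw [h] at hbad
        simp [hw.2] at hbad
      · exact h
    have htb : t ≤ b.length :=
      Nat.find_min' hex fun h => h b hb
        (by rw [List.take_length]; exact (List.suffix_append _ _).isInfix)
    have hgood : Avoids F (w ++ b.take t).dropLast := by
      have := Nat.find_min hex (show t - 1 < Nat.find hex by omega)
      rw [not_not] at this
      convert this using 1
      rw [List.dropLast_eq_take, List.take_append, List.take_take]
      congr 1
      · rw [List.take_of_length_le]; simp; omega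
      · congr 1; simp; omega
    obtain ⟨a, ha, hal⟩ := exists_suffix_of_not_avoids hbad hgood
    -- `a` must reach back to the start of `b`; otherwise it would be a proper subword of `b`.
    have hta : t ≤ a.length := by
      by_contra hlt
      have h1 : a <:+ b.take t :=
        List.suffix_of_suffix_length_le hal (List.suffix_append _ _) (by simp; omega)
      have := eq_of_infix hmin ha hb (h1.isInfix.trans (List.take_prefix t b).isInfix)
      subst this
      omega
    have hdrop : a.drop (a.length - t) = b.take t := by
      refine List.IsSuffix.eq_of_length (List.suffix_of_suffix_length_le
        ((List.drop_suffix _ a).trans hal) (List.suffix_append _ _) ?_) ?_ <;> simp <;> omega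
    refine ⟨⟨a, a.length - t, w ++ b.take t⟩, ?_, ?_⟩
    · simp only [mem_sigma, mem_endWords]
      refine ⟨ha, ?_, ?_, hal, hgood⟩
      · simp only [overlaps, mem_filter, mem_range]
        refine ⟨by omega, Or.inl ?_⟩
        rw [hdrop]
        exact List.take_prefix t b
      · simp [hw.1]; omega
    · simp [← hw.1]

end

end SFT

/-! ### Counting words by powers of the adjacency matrix -/

namespace SFT

noncomputable section

open scoped Classical
open Finset

variable {q : ℕ} {F : Finset (List (Fin q))}

/-- A forbidden word created by prepending `c` is a prefix, and it has at most `maxLength F`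
symbols, so one window decides. -/
theorem avoids_cons_iff {c : Fin q} {l : List (Fin q)} :
    Avoids F (c :: l) ↔ Avoids F l ∧ Avoids F (c :: l.take (maxLength F - 1)) := by
  constructor
  · intro h
    refine ⟨h.mono (List.suffix_cons c l).isInfix, h.mono (List.IsPrefix.isInfix ?_)⟩
    exact List.cons_prefix_cons.2 ⟨rfl, List.take_prefix _ _⟩
  · rintro ⟨h1, h2⟩ a ha hal
    rcases List.infix_cons_iff.1 hal with h | h
    · refine h2 a ha (List.IsPrefix.isInfix ?_)
      rw [← List.take_succ_cons]
      refine List.prefix_take_iff.2 ⟨h, ?_⟩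
      have : a.length ≤ maxLength F := (Finset.le_sup ha).trans (le_max_right _ _)
      omega
    · exact h1 a ha h

theorem one_le_maxLength_sub_one : 1 ≤ maxLength F - 1 := by
  have : 2 ≤ maxLength F := le_max_left _ _
  omega

theorem adjacencyMatrix_apply (hq : 0 < q) (hmin : IsMinimal F)
    (hlen : ∀ a ∈ F, 2 ≤ a.length) (x y : State F) {c : Fin q} {l : List (Fin q)}
    (hx : List.ofFn x.1 = c :: l) :
    adjacencyMatrix F x y =
      if l = (List.ofFn y.1).dropLast ∧ Avoids F (c :: List.ofFn y.1) then 1 else 0 := by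
  rw [adjacencyMatrix, Matrix.of_apply, hx, List.tail_cons]
  refine if_congr (and_congr_right fun hl => ?_) rfl rfl
  rw [isAllowed_iff hq hmin hlen, hl, List.cons_append, List.dropLast_eq_take, List.length_ofFn,
    Nat.sub_sub, List.take_append_drop]

/-- The `F`-avoiding words of length `n` beginning with the state `x`. -/
def startWords (F : Finset (List (Fin q))) (x : State F) (n : ℕ) : Finset (List (Fin q)) :=
  (words F n).filter fun l => l.take (maxLength F - 1) = List.ofFn x.1

theorem mem_startWords {x : State F} {n : ℕ} {l : List (Fin q)} :
    l ∈ startWords F x n ↔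
      (l.length = n ∧ Avoids F l) ∧ l.take (maxLength F - 1) = List.ofFn x.1 := by
  simp [startWords]

/-- Deleting the first symbol maps a word starting with `x` to a word starting with a successor
state `y`; `avoids_cons_iff` shows that the edge from `x` to `y` is the only condition for going
back. -/
theorem card_startWords_succ (hq : 0 < q) (hmin : IsMinimal F)
    (hlen : ∀ a ∈ F, 2 ≤ a.length) (x : State F) (m : ℕ) :
    ((startWords F x (maxLength F - 1 + (m + 1))).card : ℝ) =
      ∑ y, adjacencyMatrix F x y * (startWords F y (maxLength F - 1 + m)).card := by
  have hk := one_le_maxLength_sub_one (F := F)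
  set k := maxLength F - 1 with hkdef
  obtain ⟨c, X, hx⟩ : ∃ c X, List.ofFn x.1 = c :: X := by
    refine List.exists_cons_of_ne_nil fun h => ?_
    have := congrArg List.length h
    simp only [List.length_ofFn, List.length_nil] at this
    omega
  have hXlen : X.length = k - 1 := by
    have := congrArg List.length hx
    simp only [List.length_ofFn, List.length_cons] at this
    omega
  simp only [adjacencyMatrix_apply hq hmin hlen x _ hx, ite_mul, one_mul, zero_mul]
  rw [← sum_filter, ← Nat.cast_sum, ← card_sigma]
  congr 1
  symm
  refine card_bij (fun z _ => c :: z.2) ?_ ?_ ?_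
  · rintro ⟨y, l⟩ h
    simp only [mem_sigma, mem_filter, mem_univ, true_and, mem_startWords] at h ⊢
    obtain ⟨⟨hX, hav⟩, ⟨hl, hlav⟩, hly⟩ := h
    refine ⟨⟨by simp [hl]; omega, avoids_cons_iff.2 ⟨hlav, by rwa [hly]⟩⟩, ?_⟩
    rw [hx, ← hkdef, show k = k - 1 + 1 by omega, List.take_succ_cons, hX, ← hly,
      ← hkdef, List.dropLast_eq_take, List.take_take, List.length_take]
    congr 2
    omega
  · rintro ⟨y, l⟩ h ⟨y', l'⟩ h' heq
    simp only [mem_sigma, mem_filter, mem_univ, true_and, mem_startWords] at h h'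
    obtain rfl : l = l' := by simpa using heq
    have : y = y' := Subtype.ext (List.ofFn_injective (h.2.2.symm.trans h'.2.2))
    subst this
    rfl
  · intro l hl
    rw [mem_startWords] at hl
    obtain ⟨⟨hl1, hav⟩, htake⟩ := hl
    obtain ⟨d, l, rfl⟩ := List.exists_cons_of_ne_nil (l := l) (by rintro rfl; simp at hl1)
    rw [hx, ← hkdef, show k = k - 1 + 1 by omega, List.take_succ_cons, List.cons.injEq] at htake
    obtain ⟨rfl, htake⟩ := htake
    obtain ⟨h1, h2⟩ := avoids_cons_iff.1 hav
    have hl : l.length = k + m := by simp at hl1; omega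
    have h3 : Avoids F (l.take k) := h1.mono (List.take_prefix _ _).isInfix
    have h4 : (l.take k).length = k := by simp; omega
    obtain ⟨y, hy⟩ : ∃ y : Fin k → Fin q, List.ofFn y = l.take k :=
      ⟨fun i => (l.take k).get (i.cast h4.symm), by
        apply List.ext_getElem <;> simp [hl]⟩
    refine ⟨⟨⟨y, ?_⟩, l⟩, ?_, rfl⟩
    · rw [hy]
      exact h3.isAllowed hq hmin hlen
    · simp only [mem_sigma, mem_filter, mem_univ, true_and, mem_startWords]
      rw [hy]
      refine ⟨⟨?_, h2⟩, ⟨hl, h1⟩, rfl⟩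
      rw [← htake, List.dropLast_eq_take, List.take_take, h4]
      congr 1
      omega

theorem card_startWords (hq : 0 < q) (hmin : IsMinimal F)
    (hlen : ∀ a ∈ F, 2 ≤ a.length) (m : ℕ) (x : State F) :
    ((startWords F x (maxLength F - 1 + m)).card : ℝ) = ∑ y, (adjacencyMatrix F ^ m) x y := by
  induction m generalizing x with
  | zero =>
    rw [pow_zero]
    simp only [Matrix.one_apply, sum_ite_eq, mem_univ, if_true, add_zero]
    rw [Nat.cast_eq_one, card_eq_one]
    refine ⟨List.ofFn x.1, ?_⟩
    ext l
    rw [mem_startWords, mem_singleton]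
    constructor
    · rintro ⟨⟨h1, _⟩, h2⟩
      rwa [List.take_of_length_le h1.le] at h2
    · rintro rfl
      exact ⟨⟨by simp, x.2.avoids⟩, List.take_of_length_le (by simp)⟩
  | succ m ih =>
    rw [card_startWords_succ hq hmin hlen]
    simp only [ih, pow_succ', Matrix.mul_apply, mul_sum]
    rw [sum_comm]

/-- For words of length at least that of a state, `f` counts the paths of the adjacency matrix. -/
theorem wordCount_eq_sum_pow (hq : 0 < q) (hmin : IsMinimal F)
    (hlen : ∀ a ∈ F, 2 ≤ a.length) (m : ℕ) :
    (wordCount F (maxLength F - 1 + m) : ℝ) = ∑ x, ∑ y, (adjacencyMatrix F ^ m) x y := by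
  simp only [← card_startWords hq hmin hlen]
  rw [wordCount_eq, ← Nat.cast_sum, ← card_biUnion]
  · congr 2
    ext l
    simp only [mem_biUnion, mem_univ, true_and, mem_startWords, mem_words]
    constructor
    · rintro ⟨hl, hav⟩
      have h4 : (l.take (maxLength F - 1)).length = maxLength F - 1 := by simp; omega
      obtain ⟨y, hy⟩ : ∃ y : Fin (maxLength F - 1) → Fin q,
          List.ofFn y = l.take (maxLength F - 1) :=
        ⟨fun i => (l.take _).get (i.cast h4.symm), by
          apply List.ext_getElem <;> simp [hl]⟩
      refine ⟨⟨y, ?_⟩, ⟨hl, hav⟩, hy.symm⟩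
      rw [hy]
      exact (hav.mono (List.take_prefix _ _).isInfix).isAllowed hq hmin hlen
    · rintro ⟨_, h, _⟩
      exact h
  · intro x _ y _ hxy
    rw [Function.onFun, disjoint_left]
    intro l hl hl'
    rw [mem_startWords] at hl hl'
    exact hxy (Subtype.ext (List.ofFn_injective (hl.2.symm.trans hl'.2)))

theorem wordCount_pos (hq : 0 < q) (hmin : IsMinimal F) (hlen : ∀ a ∈ F, 2 ≤ a.length) (n : ℕ) :
    0 < wordCount F n := by
  rw [wordCount_eq, card_pos]
  induction n with
  | zero => exact ⟨[], by simpa using avoids_nil hlen⟩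
  | succ n ih =>
    obtain ⟨l, hl⟩ := ih
    rw [mem_words] at hl
    obtain ⟨c, hc⟩ := hl.2.exists_concat hq hmin hlen
    exact ⟨l ++ [c], by simp [hl.1, hc]⟩

theorem adjacencyMatrix_nonneg (x y : State F) : 0 ≤ adjacencyMatrix F x y := by
  rw [adjacencyMatrix, Matrix.of_apply]
  split_ifs <;> norm_num

end

end SFT

/-! ### Growth of powers of nonnegative matrices -/

namespace SFT

noncomputable section

open scoped Classical
open Finset Filter Topology

section NonnegativeMatrix

variable {n : Type*} [Fintype n] [DecidableEq n] {A : Matrix n n ℝ}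

/-- The sum of the entries of `A ^ m`. -/
def powSum (A : Matrix n n ℝ) (m : ℕ) : ℝ := ∑ x, ∑ y, (A ^ m) x y

/-- The spectral radius of a real matrix, as a real number. -/
def realSpectralRadius (A : Matrix n n ℝ) : ℝ :=
  (spectralRadius ℂ (A.map fun t : ℝ => (t : ℂ))).toReal

theorem pow_apply_nonneg (hA : ∀ x y, 0 ≤ A x y) (m : ℕ) (x y : n) : 0 ≤ (A ^ m) x y := by
  induction m generalizing x y with
  | zero => rw [pow_zero, Matrix.one_apply]; split_ifs <;> norm_num
  | succ m ih =>
    rw [pow_succ, Matrix.mul_apply]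
    exact sum_nonneg fun z _ => mul_nonneg (ih x z) (hA z y)

theorem map_ofReal_pow (A : Matrix n n ℝ) (m : ℕ) :
    (A.map fun t : ℝ => (t : ℂ)) ^ m = (A ^ m).map fun t : ℝ => (t : ℂ) :=
  (map_pow (Complex.ofRealHom.mapMatrix (m := n)) A m).symm

attribute [local instance] Matrix.linftyOpNormedRing Matrix.linftyOpNormedAlgebra

/-- The norm is the largest absolute row sum. For nonnegative entries it agrees with `powSum` up to
a factor `Fintype.card n`, so spectral radius estimates transfer to entry sums. -/
theorem norm_map_pow_le_powSum (hA : ∀ x y, 0 ≤ A x y) (m : ℕ) :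
    ‖(A.map fun t : ℝ => (t : ℂ)) ^ m‖ ≤ powSum A m := by
  have h0 := pow_apply_nonneg hA m
  have hs : 0 ≤ powSum A m := sum_nonneg fun x _ => sum_nonneg fun y _ => h0 x y
  rw [map_ofReal_pow, Matrix.linfty_opNorm_def]
  obtain ⟨s, hs'⟩ : ∃ s : NNReal, (s : ℝ) = powSum A m := ⟨⟨_, hs⟩, rfl⟩
  rw [← hs', NNReal.coe_le_coe, Finset.sup_le_iff]
  intro x _
  rw [← NNReal.coe_le_coe, hs']
  push_cast
  simp only [Matrix.map_apply, Complex.norm_real, Real.norm_of_nonneg (h0 x _)]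
  exact single_le_sum (f := fun x => ∑ y, (A ^ m) x y)
    (fun x _ => sum_nonneg fun y _ => h0 x y) (mem_univ x)

theorem powSum_le_norm_map_pow (hA : ∀ x y, 0 ≤ A x y) (m : ℕ) :
    powSum A m ≤ Fintype.card n * ‖(A.map fun t : ℝ => (t : ℂ)) ^ m‖ := by
  have h0 := pow_apply_nonneg hA m
  rw [powSum, ← nsmul_eq_mul, ← card_univ]
  refine sum_le_card_nsmul _ _ _ fun x _ => ?_
  rw [map_ofReal_pow, Matrix.linfty_opNorm_def]
  have := Finset.le_sup (f := fun i => ∑ j, ‖((A ^ m).map fun t : ℝ => (t : ℂ)) i j‖₊) (mem_univ x)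
  refine le_trans (le_of_eq ?_) (NNReal.coe_le_coe.2 this)
  push_cast
  simp only [Matrix.map_apply, Complex.norm_real, Real.norm_of_nonneg (h0 x _)]

theorem realSpectralRadius_nonneg (A : Matrix n n ℝ) : 0 ≤ realSpectralRadius A :=
  ENNReal.toReal_nonneg

theorem spectralRadius_lt_top [Nonempty n] (A : Matrix n n ℂ) : spectralRadius ℂ A < ⊤ :=
  (spectrum.spectralRadius_le_nnnorm A).trans_lt ENNReal.coe_lt_top

/-- The spectral radius is at most `‖B ^ k‖ ^ (1 / k)` for every positive `k`, whence the exponent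
`m + 1`. -/
theorem realSpectralRadius_pow_le [Nonempty n] (hA : ∀ x y, 0 ≤ A x y) (m : ℕ) :
    realSpectralRadius A ^ (m + 1) ≤ powSum A (m + 1) := by
  refine le_trans ?_ (norm_map_pow_le_powSum hA _)
  set B := A.map fun t : ℝ => (t : ℂ) with hB
  have h := spectrum.spectralRadius_le_pow_nnnorm_pow_one_div ℂ B m
  rw [nnnorm_one, ENNReal.coe_one, ENNReal.one_rpow, mul_one] at h
  have h2 := ENNReal.toReal_mono (ENNReal.rpow_ne_top_of_nonneg (by positivity)
    ENNReal.coe_ne_top) h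
  rw [← ENNReal.toReal_rpow, ENNReal.coe_toReal, coe_nnnorm] at h2
  refine (pow_le_pow_left₀ (realSpectralRadius_nonneg A) h2 (m + 1)).trans (le_of_eq ?_)
  have := Real.rpow_inv_natCast_pow (norm_nonneg (B ^ (m + 1))) (Nat.succ_ne_zero m)
  rw [← Nat.cast_succ, one_div]
  exact this

/-- Gelfand's formula gives the bound for large `m`; the finitely many other terms are absorbed in
`D`. -/
theorem exists_powSum_le [Nonempty n] (hA : ∀ x y, 0 ≤ A x y) {t : ℝ}
    (ht : realSpectralRadius A < t) : ∃ D, 0 < D ∧ ∀ m, powSum A m ≤ D * t ^ m := by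
  have ht0 : 0 < t := (realSpectralRadius_nonneg A).trans_lt ht
  set B := A.map fun t : ℝ => (t : ℂ) with hB
  have hlt : spectralRadius ℂ B < ENNReal.ofReal t :=
    (ENNReal.lt_ofReal_iff_toReal_lt (spectralRadius_lt_top B).ne).2 ht
  have hev := (spectrum.pow_norm_pow_one_div_tendsto_nhds_spectralRadius B).eventually_lt_const hlt
  have hbd : IsBoundedUnder (· ≤ ·) atTop fun m => powSum A m / t ^ m := by
    refine ⟨Fintype.card n, ?_⟩
    rw [eventually_map]
    filter_upwards [hev, eventually_gt_atTop 0] with m hm hm0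
    rw [div_le_iff₀ (by positivity)]
    refine (powSum_le_norm_map_pow hA m).trans (mul_le_mul_of_nonneg_left ?_ (by positivity))
    rw [ENNReal.ofReal_lt_ofReal_iff ht0, one_div] at hm
    have := pow_le_pow_left₀ (by positivity) hm.le m
    rwa [Real.rpow_inv_natCast_pow (norm_nonneg _) hm0.ne'] at this
  obtain ⟨D, hD⟩ := hbd.bddAbove_range
  refine ⟨max D 1, by positivity, fun m => ?_⟩
  have := (hD ⟨m, rfl⟩).trans (le_max_left D 1)
  rwa [div_le_iff₀ (by positivity)] at this

theorem powSum_nonneg (hA : ∀ x y, 0 ≤ A x y) (m : ℕ) : 0 ≤ powSum A m :=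
  sum_nonneg fun x _ => sum_nonneg fun y _ => pow_apply_nonneg hA m x y

theorem powSum_add (A : Matrix n n ℝ) (a b : ℕ) :
    powSum A (a + b) = ∑ z, (∑ x, (A ^ a) x z) * ∑ y, (A ^ b) z y := by
  simp only [powSum, pow_add, Matrix.mul_apply, sum_mul, mul_sum]
  calc _ = ∑ x, ∑ z, ∑ y, (A ^ a) x z * (A ^ b) z y := sum_congr rfl fun x _ => sum_comm
    _ = ∑ z, ∑ x, ∑ y, (A ^ a) x z * (A ^ b) z y := sum_comm
    _ = _ := sum_congr rfl fun z _ => sum_comm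

theorem powSum_add_le (hA : ∀ x y, 0 ≤ A x y) (a b : ℕ) :
    powSum A (a + b) ≤ powSum A a * powSum A b := by
  rw [powSum_add, show powSum A a = ∑ z, ∑ x, (A ^ a) x z from sum_comm, sum_mul]
  refine sum_le_sum fun z _ => mul_le_mul_of_nonneg_left ?_
    (sum_nonneg fun x _ => pow_apply_nonneg hA a x z)
  exact single_le_sum (f := fun z => ∑ y, (A ^ b) z y)
    (fun z _ => sum_nonneg fun y _ => pow_apply_nonneg hA b z y) (mem_univ z)

/-- A path of length `a` ending at `x` and one of length `b` starting at `y` are joined by a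
connection of length `l x y`. This costs a bounded factor, and submultiplicativity removes the extra
length again. -/
theorem exists_powSum_mul_le (hA : ∀ x y, 0 ≤ A x y)
    (hirr : ∀ x y, ∃ l : ℕ, 1 ≤ l ∧ 0 < (A ^ l) x y) :
    ∃ C, 0 < C ∧ ∀ a b, powSum A a * powSum A b ≤ C * powSum A (a + b) := by
  choose l _ hl using hirr
  refine ⟨∑ x, ∑ y, powSum A (l x y) / (A ^ l x y) x y + 1, ?_, fun a b => ?_⟩
  · have : 0 ≤ ∑ x, ∑ y, powSum A (l x y) / (A ^ l x y) x y :=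
      sum_nonneg fun x _ => sum_nonneg fun y _ => div_nonneg (powSum_nonneg hA _) (hl x y).le
    linarith
  set u : n → ℝ := fun x => ∑ w, (A ^ a) w x with hu
  set v : n → ℝ := fun y => ∑ w, (A ^ b) y w with hv
  have hu0 : ∀ x, 0 ≤ u x := fun x => sum_nonneg fun w _ => pow_apply_nonneg hA a w x
  have hv0 : ∀ x, 0 ≤ v x := fun x => sum_nonneg fun w _ => pow_apply_nonneg hA b x w
  have key : ∀ x y, u x * v y ≤ powSum A (l x y) / (A ^ l x y) x y * powSum A (a + b) := by
    intro x y
    rw [div_mul_eq_mul_div, le_div_iff₀ (hl x y)]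
    have h1 : (A ^ l x y) x y * v y ≤ ∑ w, (A ^ (l x y + b)) x w := by
      calc (A ^ l x y) x y * v y ≤ ∑ z, (A ^ l x y) x z * v z :=
            single_le_sum (f := fun z => (A ^ l x y) x z * v z)
              (fun z _ => mul_nonneg (pow_apply_nonneg hA _ x z) (hv0 z)) (mem_univ y)
        _ = _ := by
            simp only [pow_add, Matrix.mul_apply, hv, mul_sum]
            rw [sum_comm]
    have h2 : u x * ∑ w, (A ^ (l x y + b)) x w ≤ powSum A (a + (l x y + b)) := by
      rw [powSum_add]
      exact single_le_sum (f := fun z => u z * ∑ w, (A ^ (l x y + b)) z w)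
        (fun z _ => mul_nonneg (hu0 z) (sum_nonneg fun w _ => pow_apply_nonneg hA _ z w))
        (mem_univ x)
    have h3 : powSum A (a + (l x y + b)) ≤ powSum A (l x y) * powSum A (a + b) := by
      rw [add_left_comm]
      exact powSum_add_le hA _ _
    calc u x * v y * (A ^ l x y) x y = u x * ((A ^ l x y) x y * v y) := by ring
      _ ≤ u x * ∑ w, (A ^ (l x y + b)) x w := mul_le_mul_of_nonneg_left h1 (hu0 x)
      _ ≤ _ := h2.trans h3
  have hsum : powSum A a * powSum A b = ∑ x, ∑ y, u x * v y := by
    rw [show powSum A a = ∑ z, ∑ x, (A ^ a) x z from sum_comm]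
    exact sum_mul_sum _ _ _ _
  rw [hsum, add_mul, one_mul, sum_mul]
  simp only [sum_mul]
  exact (sum_le_sum fun x _ => sum_le_sum fun y _ => key x y).trans
    (le_add_of_nonneg_right (powSum_nonneg hA _))

/-- By `exists_powSum_mul_le`, `powSum A m / C` is supermultiplicative. If it exceeded `t ^ m` for
some `t` above the spectral radius, its powers would outgrow the bound `D * t ^ (m * (j + 1))`. Then
let `t` decrease to the spectral radius. -/
theorem exists_powSum_le_of_irreducible [Nonempty n] (hA : ∀ x y, 0 ≤ A x y)
    (hirr : ∀ x y, ∃ l : ℕ, 1 ≤ l ∧ 0 < (A ^ l) x y) :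
    ∃ C, 0 < C ∧ ∀ m, powSum A m ≤ C * realSpectralRadius A ^ m := by
  obtain ⟨C, hC, hmul⟩ := exists_powSum_mul_le hA hirr
  refine ⟨C, hC, fun m => ?_⟩
  have hpow : ∀ j : ℕ, (powSum A m / C) ^ (j + 1) ≤ powSum A (m * (j + 1)) / C := by
    intro j
    induction j with
    | zero => simp
    | succ j ih =>
      calc (powSum A m / C) ^ (j + 1 + 1) = (powSum A m / C) ^ (j + 1) * (powSum A m / C) :=
            pow_succ _ _
        _ ≤ powSum A (m * (j + 1)) / C * (powSum A m / C) :=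
            mul_le_mul_of_nonneg_right ih (div_nonneg (powSum_nonneg hA _) hC.le)
        _ = powSum A (m * (j + 1)) * powSum A m / C / C := by ring
        _ ≤ _ := by
            gcongr
            rw [div_le_iff₀ hC, mul_comm _ C, show m * (j + 1 + 1) = m * (j + 1) + m by ring]
            exact hmul _ _
  have hle : ∀ t, realSpectralRadius A < t → powSum A m / C ≤ t ^ m := by
    intro t ht
    have ht0 : 0 < t := (realSpectralRadius_nonneg A).trans_lt ht
    obtain ⟨D, hD, hDt⟩ := exists_powSum_le hA ht
    by_contra! hlt
    have hr : 1 < powSum A m / C / t ^ m := by rwa [one_lt_div (by positivity)]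
    obtain ⟨j, hj⟩ := pow_unbounded_of_one_lt (D / C) hr
    have h1 : (powSum A m / C / t ^ m) ^ (j + 1) ≤ D / C := by
      rw [div_pow, div_le_iff₀ (by positivity), ← pow_mul, div_mul_eq_mul_div]
      exact (hpow j).trans (by gcongr; exact hDt _)
    have h2 := pow_le_pow_right₀ hr.le (Nat.le_succ j)
    exact absurd (hj.trans_le (h2.trans h1)) (lt_irrefl _)
  have hlim : Tendsto (fun t : ℝ => t ^ m) (𝓝[>] realSpectralRadius A)
      (𝓝 (realSpectralRadius A ^ m)) :=
    ((continuous_pow m).tendsto _).mono_left nhdsWithin_le_nhds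
  have := ge_of_tendsto hlim (by
    filter_upwards [self_mem_nhdsWithin] with t ht using hle t ht)
  rwa [div_le_iff₀ hC, mul_comm] at this

end NonnegativeMatrix

end

end SFT

/-! ### Growth of the word count, and generating functions -/

namespace SFT

noncomputable section

open scoped Classical
open Finset Filter Topology

variable {q : ℕ} {F : Finset (List (Fin q))}

section Growth

theorem perronRoot_nonneg : 0 ≤ perronRoot F := ENNReal.toReal_nonneg

theorem nonempty_state (hq : 0 < q) (hmin : IsMinimal F) (hlen : ∀ a ∈ F, 2 ≤ a.length) :
    Nonempty (State F) := by
  have := wordCount_pos hq hmin hlen (maxLength F - 1)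
  rw [wordCount, Nat.card_pos_iff] at this
  obtain ⟨w, hw⟩ := this.1
  exact ⟨w, Avoids.isAllowed hq hmin hlen hw⟩

theorem powSum_adjacencyMatrix (hq : 0 < q) (hmin : IsMinimal F)
    (hlen : ∀ a ∈ F, 2 ≤ a.length) (m : ℕ) :
    powSum (adjacencyMatrix F) m = wordCount F (maxLength F - 1 + m) :=
  (wordCount_eq_sum_pow hq hmin hlen m).symm

theorem exists_le_mul_pow_of_shift {u : ℕ → ℝ} (hu : ∀ n, 0 ≤ u n) {k : ℕ} {D t : ℝ}
    (hD : 0 < D) (ht : 0 < t) (h : ∀ m, u (k + m) ≤ D * t ^ m) :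
    ∃ C, 0 < C ∧ ∀ n, u n ≤ C * t ^ n := by
  have hs : 0 ≤ ∑ n ∈ range k, u n / t ^ n :=
    sum_nonneg fun n _ => div_nonneg (hu n) (by positivity)
  refine ⟨D / t ^ k + ∑ n ∈ range k, u n / t ^ n, by positivity, fun n => ?_⟩
  rcases lt_or_ge n k with hn | hn
  · rw [← div_le_iff₀ (by positivity)]
    refine (single_le_sum (f := fun n => u n / t ^ n)
      (fun n _ => div_nonneg (hu n) (by positivity)) (mem_range.2 hn)).trans ?_
    exact le_add_of_nonneg_left (by positivity)
  · obtain ⟨m, rfl⟩ := Nat.exists_eq_add_of_le hn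
    calc u (k + m) ≤ D * t ^ m := h m
      _ = D / t ^ k * t ^ (k + m) := by rw [pow_add]; field_simp
      _ ≤ _ := by gcongr; exact le_add_of_nonneg_right hs

theorem exists_wordCount_le (hq : 0 < q) (hmin : IsMinimal F)
    (hlen : ∀ a ∈ F, 2 ≤ a.length) {t : ℝ} (ht : perronRoot F < t) :
    ∃ C, 0 < C ∧ ∀ n, (wordCount F n : ℝ) ≤ C * t ^ n := by
  have := nonempty_state hq hmin hlen
  obtain ⟨D, hD, h⟩ := exists_powSum_le adjacencyMatrix_nonneg ht
  simp only [powSum_adjacencyMatrix hq hmin hlen] at h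
  exact exists_le_mul_pow_of_shift (u := fun n => (wordCount F n : ℝ))
    (fun n => Nat.cast_nonneg _) hD (perronRoot_nonneg.trans_lt ht) h

theorem perronRoot_pow_le (hq : 0 < q) (hmin : IsMinimal F)
    (hlen : ∀ a ∈ F, 2 ≤ a.length) (m : ℕ) :
    perronRoot F ^ m ≤ wordCount F (maxLength F - 1 + m) := by
  have := nonempty_state hq hmin hlen
  rcases m with _ | m
  · rw [pow_zero]
    exact_mod_cast wordCount_pos hq hmin hlen _
  · rw [← powSum_adjacencyMatrix hq hmin hlen]
    exact realSpectralRadius_pow_le adjacencyMatrix_nonneg m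

/-- Avoiding words of every length exist, so `f(n)` cannot decay geometrically. In particular the
Perron root is not `0`, where the factor `z` in the generating function would interfere. -/
theorem one_le_perronRoot (hq : 0 < q) (hmin : IsMinimal F)
    (hlen : ∀ a ∈ F, 2 ≤ a.length) : 1 ≤ perronRoot F := by
  by_contra! hlt
  obtain ⟨t, ht, ht1⟩ := exists_between hlt
  have ht0 : 0 ≤ t := perronRoot_nonneg.trans ht.le
  obtain ⟨C, hC, h⟩ := exists_wordCount_le hq hmin hlen ht
  have hlim : Tendsto (fun n : ℕ => C * t ^ n) atTop (𝓝 (C * 0)) :=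
    (tendsto_pow_atTop_nhds_zero_of_lt_one ht0 ht1).const_mul C
  rw [mul_zero] at hlim
  have : (1 : ℝ) ≤ 0 := ge_of_tendsto' hlim fun n =>
    le_trans (by exact_mod_cast wordCount_pos hq hmin hlen n) (h n)
  linarith

theorem exists_wordCount_le_of_isIrreducible (hq : 0 < q) (hmin : IsMinimal F)
    (hlen : ∀ a ∈ F, 2 ≤ a.length) (hirr : IsIrreducible F) :
    ∃ C, 0 < C ∧ ∀ n, (wordCount F n : ℝ) ≤ C * perronRoot F ^ n := by
  have := nonempty_state hq hmin hlen
  obtain ⟨D, hD, h⟩ := exists_powSum_le_of_irreducible adjacencyMatrix_nonneg hirr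
  simp only [powSum_adjacencyMatrix hq hmin hlen] at h
  exact exists_le_mul_pow_of_shift (u := fun n => (wordCount F n : ℝ))
    (fun n => Nat.cast_nonneg _) hD
    (zero_lt_one.trans_le (one_le_perronRoot hq hmin hlen)) h

theorem summable_wordCount (hq : 0 < q) (hmin : IsMinimal F)
    (hlen : ∀ a ∈ F, 2 ≤ a.length) {x : ℝ} (hx : perronRoot F < x) :
    Summable fun n : ℕ => (wordCount F n : ℝ) * x⁻¹ ^ n := by
  obtain ⟨t, ht, htx⟩ := exists_between hx
  have ht0 : 0 ≤ t := perronRoot_nonneg.trans ht.le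
  have hx0 : 0 < x := ht0.trans_lt htx
  obtain ⟨C, hC, h⟩ := exists_wordCount_le hq hmin hlen ht
  refine Summable.of_nonneg_of_le (fun n => by positivity) (fun n => ?_)
    ((summable_geometric_of_lt_one (r := t / x) (by positivity)
      ((div_lt_one hx0).2 htx)).mul_left C)
  rw [div_eq_mul_inv, mul_pow, ← mul_assoc]
  exact mul_le_mul_of_nonneg_right (h n) (by positivity)

theorem summable_wordCount_complex (hq : 0 < q) (hmin : IsMinimal F)
    (hlen : ∀ a ∈ F, 2 ≤ a.length) {z : ℂ} (hz : perronRoot F < ‖z‖) :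
    Summable fun n : ℕ => (wordCount F n : ℂ) * z⁻¹ ^ n := by
  refine Summable.of_norm ?_
  simpa using summable_wordCount hq hmin hlen hz

theorem summable_card_endWords (hq : 0 < q) (hmin : IsMinimal F)
    (hlen : ∀ a ∈ F, 2 ≤ a.length) {a : List (Fin q)} (ha : a ∈ F) {z : ℂ}
    (hz : perronRoot F < ‖z‖) :
    Summable fun n : ℕ => ((endWords F a n).card : ℂ) * z⁻¹ ^ n := by
  refine (summable_nat_add_iff 1).1 ?_
  refine Summable.of_norm_bounded
    (((summable_wordCount hq hmin hlen hz).mul_left (q : ℝ)).mul_left ‖z‖⁻¹) fun n => ?_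
  -- Deleting the last symbol costs at most a factor `q`, so convergence is inherited from the word
  -- count.
  have h1 : (endWords F a (n + 1)).card ≤ q * wordCount F n := by
    rw [wordCount_eq, card_words_mul hmin]
    exact le_add_left (single_le_sum (f := fun a => (endWords F a (n + 1)).card)
      (fun _ _ => Nat.zero_le _) ha)
  have h2 : ((endWords F a (n + 1)).card : ℝ) ≤ q * wordCount F n := by exact_mod_cast h1
  simp only [norm_mul, norm_pow, norm_inv, Complex.norm_natCast]
  calc _ ≤ (q * wordCount F n : ℝ) * ‖z‖⁻¹ ^ (n + 1) := by gcongr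
    _ = _ := by ring

/-- The generating function of the number of avoiding words. -/
def wordGen (F : Finset (List (Fin q))) (z : ℂ) : ℂ := ∑' n : ℕ, (wordCount F n : ℂ) * z⁻¹ ^ n

/-- The generating function of the number of first occurrences of `a`. -/
def endGen (F : Finset (List (Fin q))) (a : List (Fin q)) (z : ℂ) : ℂ :=
  ∑' n : ℕ, ((endWords F a n).card : ℂ) * z⁻¹ ^ n

theorem hasSum_wordGen (hq : 0 < q) (hmin : IsMinimal F)
    (hlen : ∀ a ∈ F, 2 ≤ a.length) {z : ℂ} (hz : perronRoot F < ‖z‖) :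
    HasSum (fun n : ℕ => (wordCount F n : ℂ) * z⁻¹ ^ n) (wordGen F z) :=
  (summable_wordCount_complex hq hmin hlen hz).hasSum

theorem continuousAt_wordGen (hq : 0 < q) (hmin : IsMinimal F)
    (hlen : ∀ a ∈ F, 2 ≤ a.length) {z : ℂ} (hz : perronRoot F < ‖z‖) :
    ContinuousAt (wordGen F) z := by
  obtain ⟨t, ht, htz⟩ := exists_between hz
  have ht0 : 0 < t := zero_lt_one.trans_le ((one_le_perronRoot hq hmin hlen).trans ht.le)
  have hcont : ContinuousOn (wordGen F) {w : ℂ | t < ‖w‖} := by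
    refine continuousOn_tsum (fun n => ?_) (summable_wordCount hq hmin hlen ht) fun n w hw => ?_
    · refine continuousOn_const.mul ((continuousOn_inv₀.mono fun w hw => ?_).pow n)
      exact norm_pos_iff.1 (ht0.trans hw)
    · simp only [norm_mul, norm_pow, norm_inv, Complex.norm_natCast]
      have : t ≤ ‖w‖ := le_of_lt hw
      gcongr
  exact hcont.continuousAt ((isOpen_lt continuous_const continuous_norm).mem_nhds htz)

/-- The generating function identity expressing that a symbol is appended. -/
theorem wordGen_append_symbol (hq : 0 < q) (hmin : IsMinimal F)
    (hlen : ∀ a ∈ F, 2 ≤ a.length) {z : ℂ} (hz : perronRoot F < ‖z‖) :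
    (z - q) * wordGen F z + z * ∑ a ∈ F, endGen F a z = z := by
  have hz0 : z ≠ 0 := norm_pos_iff.1 (perronRoot_nonneg.trans_lt hz)
  have hw := hasSum_wordGen hq hmin hlen hz
  have hw1 := (hasSum_nat_add_iff' 1).2 hw
  have he : ∀ a ∈ F, HasSum (fun n : ℕ => ((endWords F a (n + 1)).card : ℂ) * z⁻¹ ^ (n + 1))
      (endGen F a z) := by
    intro a ha
    have := (hasSum_nat_add_iff' 1).2 (summable_card_endWords hq hmin hlen ha hz).hasSum
    rw [sum_range_one, endWords_eq_empty (by linarith [hlen a ha])] at this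
    simpa [endGen] using this
  have hsum := hw1.add (hasSum_sum he)
  have heq : (fun n : ℕ => (wordCount F (n + 1) : ℂ) * z⁻¹ ^ (n + 1) +
      ∑ a ∈ F, ((endWords F a (n + 1)).card : ℂ) * z⁻¹ ^ (n + 1)) =
      fun n : ℕ => q * z⁻¹ * ((wordCount F n : ℂ) * z⁻¹ ^ n) := by
    funext n
    have h := congrArg (Nat.cast : ℕ → ℂ) (card_words_mul hmin n)
    push_cast at h
    rw [← sum_mul, ← add_mul, wordCount_eq, wordCount_eq, ← h]
    ring
  rw [heq] at hsum
  have h2 := hsum.unique (hw.mul_left _)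
  have h0 : wordCount F 0 = 1 := by
    rw [wordCount_eq, card_eq_one]
    refine ⟨[], ?_⟩
    ext l
    rw [mem_words, mem_singleton, List.length_eq_zero_iff]
    exact ⟨fun h => h.1, fun h => ⟨h, h ▸ avoids_nil hlen⟩⟩
  rw [sum_range_one, h0] at h2
  have h3 := congrArg (fun t => z * t) h2
  simp only [pow_zero, Nat.cast_one, mul_one] at h3
  rw [← mul_assoc, mul_left_comm z, mul_inv_cancel₀ hz0] at h3
  linear_combination h3

theorem corr_eval (a b : List (Fin q)) (z : ℂ) :
    (corr a b).eval z = ∑ l ∈ overlaps a b, z ^ (a.length - 1 - l) := by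
  rw [corr, Polynomial.eval_finsetSum, overlaps, sum_filter]
  refine sum_congr rfl fun l _ => ?_
  split_ifs <;> simp

/-- The generating function identity expressing that a forbidden word is appended. -/
theorem wordGen_append_word (hq : 0 < q) (hmin : IsMinimal F)
    (hlen : ∀ a ∈ F, 2 ≤ a.length) {b : List (Fin q)} (hb : b ∈ F) {z : ℂ}
    (hz : perronRoot F < ‖z‖) :
    wordGen F z = ∑ a ∈ F, (corr a b).eval z * (z * endGen F a z) := by
  have hz0 : z ≠ 0 := norm_pos_iff.1 (perronRoot_nonneg.trans_lt hz)
  have key : ∀ a ∈ F, ∀ l ∈ overlaps a b,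
      HasSum (fun n => ((endWords F a (n + (a.length - l))).card : ℂ) * z⁻¹ ^ n)
        (z ^ (a.length - 1 - l) * (z * endGen F a z)) := by
    intro a ha l hl
    simp only [overlaps, mem_filter, mem_range] at hl
    have h := (hasSum_nat_add_iff' (a.length - l)).2
      (summable_card_endWords hq hmin hlen ha hz).hasSum
    rw [sum_eq_zero, sub_zero] at h
    · have h' := h.mul_left (z ^ (a.length - l))
      have e1 : z ^ (a.length - 1 - l) * (z * endGen F a z) =
          z ^ (a.length - l) * endGen F a z := by
        rw [← mul_assoc, ← pow_succ]
        congr 2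
        omega
      rw [e1]
      have e2 : (fun n => ((endWords F a (n + (a.length - l))).card : ℂ) * z⁻¹ ^ n) =
          fun n => z ^ (a.length - l) *
            (((endWords F a (n + (a.length - l))).card : ℂ) * z⁻¹ ^ (n + (a.length - l))) := by
        funext n
        rw [pow_add, inv_pow z (a.length - l)]
        field_simp
      rwa [e2]
    -- Shifting the index loses nothing: a word shorter than `a` cannot end in `a`.
    · intro i hi
      rw [endWords_eq_empty]
      · simp
      · rw [mem_range] at hi
        omega
  have h := hasSum_sum fun a ha => hasSum_sum (key a ha)
  refine (hasSum_wordGen hq hmin hlen hz).unique ?_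
  convert h using 1
  · funext n
    rw [wordCount_eq, card_words_eq hmin hb]
    push_cast
    simp only [sum_mul]
  · simp only [corr_eval, sum_mul]

end Growth

end

end SFT

/-! ### Orders of rational functions -/

namespace SFT

noncomputable section

open scoped Classical
open Finset Filter Topology Polynomial

theorem withTop_eq_neg_one {a : WithTop ℤ} (ha : a < 0) (h : 0 ≤ 1 + a) : a = -1 := by
  lift a to ℤ using ha.ne_top
  have h1 : a < 0 := by exact_mod_cast ha
  have h2 : 0 ≤ 1 + a := by exact_mod_cast h
  rw [show a = -1 by omega]
  rfl

theorem withTop_pos_of_add_eq_zero {a b : WithTop ℤ} (h : a + b = 0) : a < 0 ↔ 0 < b := by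
  lift a to ℤ using (fun ha => by simp [ha] at h)
  lift b to ℤ using (fun hb => by simp [hb] at h)
  norm_cast at *
  omega

theorem withTop_eq_one_of_neg_one_add {b : WithTop ℤ} (h : -1 + b = 0) : b = 1 := by
  lift b to ℤ using (fun hb => by simp [hb] at h)
  have h' : ((-1 + b : ℤ) : WithTop ℤ) = (0 : ℤ) := h
  have := WithTop.coe_injective h'
  rw [show b = 1 by omega]
  rfl

section RationalFunction

theorem eventually_eval_ne_zero {p : ℂ[X]} (hp : p ≠ 0) (z : ℂ) :
    ∀ᶠ w in 𝓝[≠] z, p.eval w ≠ 0 := by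
  have hfin : ({w | p.IsRoot w} \ {z}).Finite :=
    (Polynomial.finite_setOfPred_isRoot hp).subset Set.sdiff_subset
  filter_upwards [nhdsWithin_le_nhds (hfin.isClosed.isOpen_compl.mem_nhds (by simp)),
    self_mem_nhdsWithin] with w hw hwz h0
  exact hw ⟨h0, hwz⟩

theorem analyticAt_eval (p : ℂ[X]) (z : ℂ) : AnalyticAt ℂ (fun w => p.eval w) z :=
  p.differentiable.analyticAt z

theorem toFun_eq (g : RatFunc ℂ) (z : ℂ) : toFun g z = g.num.eval z / g.denom.eval z := rfl

theorem meromorphicAt_toFun (g : RatFunc ℂ) (z : ℂ) : MeromorphicAt (toFun g) z :=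
  (analyticAt_eval g.num z).meromorphicAt.div (analyticAt_eval g.denom z).meromorphicAt

theorem num_mul_eq {g : RatFunc ℂ} {N D : ℂ[X]}
    (h : g * algebraMap ℂ[X] (RatFunc ℂ) D = algebraMap ℂ[X] (RatFunc ℂ) N) :
    g.num * D = N * g.denom := by
  have hd : algebraMap ℂ[X] (RatFunc ℂ) g.denom ≠ 0 := RatFunc.algebraMap_ne_zero g.denom_ne_zero
  apply RatFunc.algebraMap_injective ℂ
  rw [map_mul, map_mul, ← h]
  conv_rhs => rw [← RatFunc.num_div_denom g]
  rw [RatFunc.num_div_denom]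
  conv_rhs => rw [mul_right_comm]
  congr 1
  rw [← div_eq_iff hd, RatFunc.num_div_denom]

/-- Evaluation is in lowest terms, so an arbitrary fraction `N / D` can be compared with it only off
the zeros of the reduced denominator; a punctured neighbourhood is enough for orders. -/
theorem eventually_toFun_mul_eval {g : RatFunc ℂ} {N D : ℂ[X]}
    (h : g * algebraMap ℂ[X] (RatFunc ℂ) D = algebraMap ℂ[X] (RatFunc ℂ) N) (z : ℂ) :
    ∀ᶠ w in 𝓝[≠] z, toFun g w * D.eval w = N.eval w := by
  filter_upwards [eventually_eval_ne_zero g.denom_ne_zero z] with w hw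
  have := congrArg (Polynomial.eval w) (num_mul_eq h)
  rw [eval_mul, eval_mul] at this
  rw [toFun_eq, div_mul_eq_mul_div, this, mul_div_cancel_right₀ _ hw]

/-- Here `g = X D / P` and `h = P / D`, so `g h = X`, which has order `0` away from the origin. -/
theorem orderAt_add_orderAt {g h : RatFunc ℂ} {D P : ℂ[X]} (hP : P ≠ 0) (hD : D ≠ 0)
    (hg : g * algebraMap ℂ[X] (RatFunc ℂ) P = algebraMap ℂ[X] (RatFunc ℂ) (X * D))
    (hh : h * algebraMap ℂ[X] (RatFunc ℂ) D = algebraMap ℂ[X] (RatFunc ℂ) P)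
    {z : ℂ} (hz : z ≠ 0) : orderAt g z + orderAt h z = 0 := by
  rw [orderAt, orderAt, ← meromorphicOrderAt_mul (meromorphicAt_toFun g z)
    (meromorphicAt_toFun h z)]
  have heq : toFun g * toFun h =ᶠ[𝓝[≠] z] id := by
    filter_upwards [eventually_toFun_mul_eval hg z, eventually_toFun_mul_eval hh z,
      eventually_eval_ne_zero hP z, eventually_eval_ne_zero hD z] with w h1 h2 h3 h4
    rw [eval_mul, eval_X] at h1
    rw [Pi.mul_apply, id]
    apply mul_right_cancel₀ h4
    rw [mul_assoc, h2, h1]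
  rw [meromorphicOrderAt_congr heq, analyticAt_id.meromorphicOrderAt_eq,
    (analyticAt_id.analyticOrderAt_eq_zero).2 hz]
  rfl

end RationalFunction

variable {q : ℕ} {F : Finset (List (Fin q))}

/-! ### The correlation matrix and the rational generating function -/

/-- The correlation matrix, with polynomial entries. -/
def corrPoly (F : Finset (List (Fin q))) : Matrix F F ℂ[X] :=
  Matrix.of fun i j => corr j.1 i.1

theorem corrMatrix_eq_map : corrMatrix F = (corrPoly F).map (algebraMap ℂ[X] (RatFunc ℂ)) := rfl

theorem det_corrMatrix :
    (corrMatrix F).det = algebraMap ℂ[X] (RatFunc ℂ) (corrPoly F).det := by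
  rw [corrMatrix_eq_map]
  exact ((algebraMap ℂ[X] (RatFunc ℂ)).map_det (corrPoly F)).symm

theorem zero_mem_overlaps_iff (hmin : IsMinimal F) (hlen : ∀ a ∈ F, 2 ≤ a.length)
    {a b : List (Fin q)} (ha : a ∈ F) (hb : b ∈ F) : 0 ∈ overlaps a b ↔ a = b := by
  have := hlen a ha
  simp only [overlaps, mem_filter, mem_range, List.drop_zero]
  constructor
  · rintro ⟨_, h | h⟩
    · exact eq_of_infix hmin ha hb h.isInfix
    · exact (eq_of_infix hmin hb ha h.isInfix).symm
  · rintro rfl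
    exact ⟨by omega, Or.inl List.prefix_rfl⟩

/-- At a large real point the correlation matrix is dominated by its diagonal. -/
theorem det_corrPoly_ne_zero (hmin : IsMinimal F) (hlen : ∀ a ∈ F, 2 ≤ a.length) :
    (corrPoly F).det ≠ 0 := by
  -- In column `j` the diagonal entry is at least `x ^ (j.1.length - 1)`. Each of the fewer than
  -- `F.card` others has at most `F.sup List.length` terms, none with `l = 0`, hence of size at most
  -- `x ^ (j.1.length - 2)`. So any `x ≥ 1` above `N` gives dominance.
  set N : ℕ := F.card * F.sup List.length with hN
  set x : ℝ := N + 1 with hx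
  have hx1 : 1 ≤ x := by simp [hx]
  intro h0
  have h1 : ((corrPoly F).map (Polynomial.eval (x : ℂ))).det = 0 := by
    have := (Polynomial.evalRingHom (x : ℂ)).map_det (corrPoly F)
    rw [h0, map_zero] at this
    exact this.symm
  refine det_ne_zero_of_sum_col_lt_diag (fun j => ?_) h1
  simp only [Matrix.map_apply, corrPoly, Matrix.of_apply, corr_eval]
  have hj := hlen _ j.2
  have hdiag : x ^ (j.1.length - 1) ≤
      ‖∑ l ∈ overlaps j.1 j.1, (x : ℂ) ^ (j.1.length - 1 - l)‖ := by
    have : ∑ l ∈ overlaps j.1 j.1, (x : ℂ) ^ (j.1.length - 1 - l) =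
        ((∑ l ∈ overlaps j.1 j.1, x ^ (j.1.length - 1 - l) : ℝ) : ℂ) := by push_cast; rfl
    rw [this, Complex.norm_real, Real.norm_of_nonneg (sum_nonneg fun l _ => by positivity)]
    exact single_le_sum (f := fun l => x ^ (j.1.length - 1 - l)) (fun l _ => by positivity)
      ((zero_mem_overlaps_iff hmin hlen j.2 j.2).2 rfl)
  refine lt_of_lt_of_le ?_ hdiag
  have hoff : ∀ i ∈ univ.erase j, ‖∑ l ∈ overlaps j.1 i.1, (x : ℂ) ^ (j.1.length - 1 - l)‖ ≤
      (F.sup List.length : ℕ) * x ^ (j.1.length - 2) := by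
    intro i hi
    refine (norm_sum_le _ _).trans ?_
    refine (sum_le_card_nsmul _ _ (x ^ (j.1.length - 2)) fun l hl => ?_).trans ?_
    · rw [norm_pow, Complex.norm_real, Real.norm_of_nonneg (by linarith)]
      refine pow_le_pow_right₀ hx1 ?_
      have : l ≠ 0 := by
        rintro rfl
        rw [zero_mem_overlaps_iff hmin hlen j.2 i.2] at hl
        exact (mem_erase.1 hi).1 (Subtype.ext hl.symm)
      omega
    · rw [nsmul_eq_mul]
      have h1 : (overlaps j.1 i.1).card ≤ F.sup List.length :=
        ((card_filter_le _ _).trans (card_range _).le).trans (Finset.le_sup (f := List.length) j.2)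
      gcongr
  refine (sum_le_card_nsmul _ _ _ hoff).trans_lt ?_
  rw [nsmul_eq_mul, ← mul_assoc]
  have hcard : (univ.erase j).card ≤ F.card := by
    rw [card_erase_of_mem (mem_univ j), card_univ, Fintype.card_coe]
    omega
  rw [show j.1.length - 1 = (j.1.length - 2) + 1 by omega, pow_succ' x]
  refine mul_lt_mul_of_pos_right ?_ (by positivity)
  rw [hx]
  have : (univ.erase j).card * F.sup List.length ≤ N := Nat.mul_le_mul_right _ hcard
  have : (((univ.erase j).card * F.sup List.length : ℕ) : ℝ) ≤ N := by exact_mod_cast this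
  push_cast at this
  linarith

/-- The numerator of `(z - q) + r(z)` over the determinant of the correlation matrix. -/
def charNum (F : Finset (List (Fin q))) : ℂ[X] :=
  (X - C (q : ℂ)) * (corrPoly F).det + ∑ i, ∑ j, (corrPoly F).adjugate i j

theorem charFun_mul_det (hdet : (corrPoly F).det ≠ 0) :
    charFun F * algebraMap ℂ[X] (RatFunc ℂ) (corrPoly F).det =
      algebraMap ℂ[X] (RatFunc ℂ) (charNum F) := by
  have hd : algebraMap ℂ[X] (RatFunc ℂ) (corrPoly F).det ≠ 0 := RatFunc.algebraMap_ne_zero hdet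
  have hadj : (corrMatrix F).adjugate =
      (corrPoly F).adjugate.map (algebraMap ℂ[X] (RatFunc ℂ)) := by
    rw [corrMatrix_eq_map]
    exact ((algebraMap ℂ[X] (RatFunc ℂ)).map_adjugate (corrPoly F)).symm
  have hinv : ∀ i j, (corrMatrix F)⁻¹ i j * algebraMap ℂ[X] (RatFunc ℂ) (corrPoly F).det =
      algebraMap ℂ[X] (RatFunc ℂ) ((corrPoly F).adjugate i j) := by
    intro i j
    rw [Matrix.inv_def, det_corrMatrix, hadj, Ring.inverse_eq_inv', Matrix.smul_apply,
      Matrix.map_apply, smul_eq_mul, mul_right_comm, inv_mul_cancel₀ hd, one_mul]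
  rw [charFun, corrSum, charNum, add_mul, sum_mul]
  simp only [sum_mul, hinv, map_add, map_mul, map_sub, map_sum, RatFunc.algebraMap_X,
    RatFunc.algebraMap_C]

/-- The identities for appending forbidden words read `M v = W · (1, …, 1)` with `v a = z E_a`.
Multiplying by the adjugate instead of an inverse keeps the result valid where `det M` vanishes at
`z`. -/
theorem wordGen_mul_charNum (hq : 0 < q) (hmin : IsMinimal F)
    (hlen : ∀ a ∈ F, 2 ≤ a.length) {z : ℂ} (hz : perronRoot F < ‖z‖) :
    wordGen F z * (charNum F).eval z = z * (corrPoly F).det.eval z := by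
  set M := (corrPoly F).map (Polynomial.eval z) with hM
  have hdet : (corrPoly F).det.eval z = M.det :=
    (Polynomial.evalRingHom z).map_det (corrPoly F)
  have hadj : ∀ i j, ((corrPoly F).adjugate i j).eval z = M.adjugate i j := fun i j =>
    congrFun (congrFun ((Polynomial.evalRingHom z).map_adjugate (corrPoly F)) i) j
  set v : F → ℂ := fun a => z * endGen F a.1 z with hv
  have hMv : M.mulVec v = fun _ => wordGen F z := by
    funext i
    rw [wordGen_append_word hq hmin hlen i.2 hz, ← Finset.sum_coe_sort F]
    rfl
  have hvdet : ∀ j, M.det * v j = wordGen F z * ∑ i, M.adjugate j i := by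
    intro j
    have h := congrArg (fun t => M.adjugate.mulVec t j) hMv
    simp only [Matrix.mulVec_mulVec, Matrix.adjugate_mul, Matrix.smul_mulVec,
      Matrix.one_mulVec, Pi.smul_apply, smul_eq_mul] at h
    rw [h, Matrix.mulVec, dotProduct, mul_sum]
    exact sum_congr rfl fun i _ => mul_comm _ _
  have h1 := wordGen_append_symbol hq hmin hlen hz
  rw [← Finset.sum_coe_sort F, mul_sum] at h1
  have h2 : M.det * ∑ j, v j = wordGen F z * ∑ j, ∑ i, M.adjugate j i := by
    rw [mul_sum, mul_sum]
    exact sum_congr rfl fun j _ => hvdet j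
  rw [charNum, eval_add, eval_mul, hdet, eval_finsetSum]
  simp only [eval_finsetSum, hadj, eval_sub, eval_X, eval_C]
  linear_combination M.det * h1 - h2

theorem charNum_ne_zero (hq : 0 < q) (hmin : IsMinimal F) (hlen : ∀ a ∈ F, 2 ≤ a.length) :
    charNum F ≠ 0 := by
  intro h0
  set z : ℂ := ((perronRoot F + 1 : ℝ) : ℂ)
  have hz : perronRoot F < ‖z‖ := by
    rw [Complex.norm_real, Real.norm_of_nonneg (by linarith [perronRoot_nonneg (F := F)])]
    linarith
  have h1 : ∀ᶠ w in 𝓝[≠] z, perronRoot F < ‖w‖ :=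
    nhdsWithin_le_nhds ((isOpen_lt continuous_const continuous_norm).mem_nhds hz)
  obtain ⟨w, hw, hw'⟩ :=
    (h1.and (eventually_eval_ne_zero (det_corrPoly_ne_zero hmin hlen) z)).exists
  have := wordGen_mul_charNum hq hmin hlen hw
  rw [h0, eval_zero, mul_zero, eq_comm, mul_eq_zero] at this
  exact this.elim (norm_pos_iff.1 (perronRoot_nonneg.trans_lt hw)) hw'

/-- The generating function of the number of avoiding words, as a rational function. -/
def genFun (F : Finset (List (Fin q))) : RatFunc ℂ :=
  algebraMap ℂ[X] (RatFunc ℂ) (X * (corrPoly F).det) / algebraMap ℂ[X] (RatFunc ℂ) (charNum F)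

theorem genFun_mul_charNum (hq : 0 < q) (hmin : IsMinimal F) (hlen : ∀ a ∈ F, 2 ≤ a.length) :
    genFun F * algebraMap ℂ[X] (RatFunc ℂ) (charNum F) =
      algebraMap ℂ[X] (RatFunc ℂ) (X * (corrPoly F).det) :=
  div_mul_cancel₀ _ (RatFunc.algebraMap_ne_zero (charNum_ne_zero hq hmin hlen))

/-- At zeros of `charNum F` the identity cannot be divided out; since these are isolated, continuity
of `wordGen F` fills them in. -/
theorem wordGen_mul_denom (hq : 0 < q) (hmin : IsMinimal F) (hlen : ∀ a ∈ F, 2 ≤ a.length)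
    {z : ℂ} (hz : perronRoot F < ‖z‖) :
    wordGen F z * (genFun F).denom.eval z = (genFun F).num.eval z := by
  have hmul := num_mul_eq (genFun_mul_charNum hq hmin hlen)
  have hev : ∀ᶠ w in 𝓝[≠] z,
      wordGen F w * (genFun F).denom.eval w - (genFun F).num.eval w = 0 := by
    filter_upwards [eventually_eval_ne_zero (charNum_ne_zero hq hmin hlen) z,
      nhdsWithin_le_nhds ((isOpen_lt continuous_const continuous_norm).mem_nhds hz)] with w hw hw'
    have h1 := congrArg (Polynomial.eval w) hmul
    have h2 := wordGen_mul_charNum hq hmin hlen hw'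
    simp only [eval_mul, eval_X] at h1
    apply mul_right_cancel₀ hw
    linear_combination (genFun F).denom.eval w * h2 - h1
  have hcont : ContinuousAt
      (fun w => wordGen F w * (genFun F).denom.eval w - (genFun F).num.eval w) z :=
    ((continuousAt_wordGen hq hmin hlen hz).mul (genFun F).denom.continuousAt).sub
      (genFun F).num.continuousAt
  have h1 := hcont.tendsto.mono_left (nhdsWithin_le_nhds (s := {z}ᶜ))
  exact sub_eq_zero.1
    (tendsto_nhds_unique h1 (tendsto_const_nhds.congr' (hev.mono fun _ h => h.symm)))

/-- Since `wordGen F z` is finite, a zero of the denominator would also be a zero of the numerator,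
against coprimality. -/
theorem denom_genFun_ne_zero (hq : 0 < q) (hmin : IsMinimal F)
    (hlen : ∀ a ∈ F, 2 ≤ a.length) {z : ℂ} (hz : perronRoot F < ‖z‖) :
    (genFun F).denom.eval z ≠ 0 := by
  intro h0
  have h1 := wordGen_mul_denom hq hmin hlen hz
  rw [h0, mul_zero] at h1
  obtain ⟨u, v, huv⟩ := RatFunc.isCoprime_num_denom (genFun F)
  have := congrArg (Polynomial.eval z) huv
  simp [h0, ← h1] at this

theorem toFun_genFun (hq : 0 < q) (hmin : IsMinimal F) (hlen : ∀ a ∈ F, 2 ≤ a.length)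
    {z : ℂ} (hz : perronRoot F < ‖z‖) : toFun (genFun F) z = wordGen F z := by
  rw [toFun_eq, div_eq_iff (denom_genFun_ne_zero hq hmin hlen hz),
    wordGen_mul_denom hq hmin hlen hz]

/-! ### The pole at the Perron root -/

theorem hasSum_norm_genFun (hq : 0 < q) (hmin : IsMinimal F) (hlen : ∀ a ∈ F, 2 ≤ a.length)
    {x : ℝ} (hx : perronRoot F < x) :
    HasSum (fun n : ℕ => (wordCount F n : ℝ) * x⁻¹ ^ n) ‖toFun (genFun F) (x : ℂ)‖ := by
  have hx0 : 0 < x := perronRoot_nonneg.trans_lt hx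
  have hz : perronRoot F < ‖(x : ℂ)‖ := by
    rwa [Complex.norm_real, Real.norm_of_nonneg hx0.le]
  have h := (summable_wordCount hq hmin hlen hx).hasSum
  have h1 : HasSum (fun n : ℕ => (wordCount F n : ℂ) * (x : ℂ)⁻¹ ^ n)
      ((∑' n : ℕ, (wordCount F n : ℝ) * x⁻¹ ^ n : ℝ) : ℂ) := by
    simpa using Complex.hasSum_ofReal.2 h
  rw [toFun_genFun hq hmin hlen hz, (hasSum_wordGen hq hmin hlen hz).unique h1, Complex.norm_real,
    Real.norm_of_nonneg (tsum_nonneg fun n => by positivity)]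
  exact h

/-- From the index `maxLength F - 1` on, the series dominates a geometric series of ratio
`perronRoot F / x`; the inequality is its sum with denominators cleared. -/
theorem le_norm_genFun_mul (hq : 0 < q) (hmin : IsMinimal F) (hlen : ∀ a ∈ F, 2 ≤ a.length)
    {x : ℝ} (hx : perronRoot F < x) :
    x ≤ ‖toFun (genFun F) (x : ℂ)‖ * (x ^ (maxLength F - 1) * (x - perronRoot F)) := by
  have hx0 : 0 < x := perronRoot_nonneg.trans_lt hx
  have h := hasSum_norm_genFun hq hmin hlen hx
  have hg := (hasSum_geometric_of_lt_one (r := perronRoot F / x)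
    (div_nonneg perronRoot_nonneg hx0.le) ((div_lt_one hx0).2 hx)).mul_left
      (x⁻¹ ^ (maxLength F - 1))
  have hle : x⁻¹ ^ (maxLength F - 1) * (1 - perronRoot F / x)⁻¹ ≤
      ‖toFun (genFun F) (x : ℂ)‖ := by
    have hshift := (hasSum_nat_add_iff' (maxLength F - 1)).2 h
    refine (hasSum_le (fun m => ?_) hg hshift).trans
      (sub_le_self _ (sum_nonneg fun n _ => by positivity))
    rw [add_comm m, pow_add, div_eq_mul_inv, mul_pow]
    have := perronRoot_pow_le hq hmin hlen m
    calc _ = perronRoot F ^ m * (x⁻¹ ^ (maxLength F - 1) * x⁻¹ ^ m) := by ring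
      _ ≤ _ := by gcongr
  have hpos : 0 < x - perronRoot F := sub_pos.2 hx
  calc x = x⁻¹ ^ (maxLength F - 1) * (1 - perronRoot F / x)⁻¹ *
        (x ^ (maxLength F - 1) * (x - perronRoot F)) := by
        rw [one_sub_div hx0.ne', inv_div, inv_pow]
        field_simp
    _ ≤ _ := by gcongr

theorem exists_norm_genFun_mul_le (hq : 0 < q) (hmin : IsMinimal F)
    (hlen : ∀ a ∈ F, 2 ≤ a.length) (hirr : IsIrreducible F) :
    ∃ C, ∀ x : ℝ, perronRoot F < x →
      ‖toFun (genFun F) (x : ℂ)‖ * (x - perronRoot F) ≤ C * x := by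
  obtain ⟨C, hC, hle⟩ := exists_wordCount_le_of_isIrreducible hq hmin hlen hirr
  refine ⟨C, fun x hx => ?_⟩
  have hx0 : 0 < x := perronRoot_nonneg.trans_lt hx
  have hg := (hasSum_geometric_of_lt_one (r := perronRoot F / x)
    (div_nonneg perronRoot_nonneg hx0.le) ((div_lt_one hx0).2 hx)).mul_left C
  have h := hasSum_le (fun n => ?_) (hasSum_norm_genFun hq hmin hlen hx) hg
  · rw [one_sub_div hx0.ne', inv_div, ← mul_div_assoc, le_div_iff₀ (sub_pos.2 hx)] at h
    exact h
  · rw [div_eq_mul_inv, mul_pow, ← mul_assoc]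
    exact mul_le_mul_of_nonneg_right (hle n) (by positivity)

theorem tendsto_ofReal_nhdsGT (t : ℝ) :
    Tendsto (fun x : ℝ => (x : ℂ)) (𝓝[>] t) (𝓝[≠] (t : ℂ)) := by
  refine tendsto_nhdsWithin_iff.2 ⟨(Complex.continuous_ofReal.tendsto t).mono_left
    nhdsWithin_le_nhds, ?_⟩
  filter_upwards [self_mem_nhdsWithin] with x hx
  exact fun h => (ne_of_gt (Set.mem_Ioi.1 hx)) (Complex.ofReal_injective h)

/-- Without a pole the function would have a finite limit along real `x` decreasing to the Perron
root, and `le_norm_genFun_mul` would give `perronRoot F ≤ 0`. -/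
theorem orderAt_genFun_neg (hq : 0 < q) (hmin : IsMinimal F) (hlen : ∀ a ∈ F, 2 ≤ a.length) :
    orderAt (genFun F) (perronRoot F : ℂ) < 0 := by
  by_contra! hnonneg
  obtain ⟨c, hc⟩ := tendsto_nhds_of_meromorphicOrderAt_nonneg (meromorphicAt_toFun _ _) hnonneg
  have h1 := (hc.comp (tendsto_ofReal_nhdsGT _)).norm
  have hpoly : Tendsto (fun x : ℝ => x ^ (maxLength F - 1) * (x - perronRoot F))
      (𝓝[>] perronRoot F)
      (𝓝 (perronRoot F ^ (maxLength F - 1) * (perronRoot F - perronRoot F))) :=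
    ((by fun_prop : Continuous fun x : ℝ => x ^ (maxLength F - 1) * (x - perronRoot F)).tendsto
      _).mono_left nhdsWithin_le_nhds
  have hid : Tendsto (fun x : ℝ => x) (𝓝[>] perronRoot F) (𝓝 (perronRoot F)) := nhdsWithin_le_nhds
  have := le_of_tendsto_of_tendsto hid (h1.mul hpoly) (by
    filter_upwards [self_mem_nhdsWithin] with x hx using le_norm_genFun_mul hq hmin hlen hx)
  rw [sub_self, mul_zero, mul_zero] at this
  linarith [one_le_perronRoot hq hmin hlen]

/-- Multiplication by `z - θ` leaves a function bounded along real `x` decreasing to `θ`; a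
meromorphic function with a pole is unbounded along every approach, so no pole is left. -/
theorem orderAt_genFun_of_isIrreducible (hq : 0 < q) (hmin : IsMinimal F)
    (hlen : ∀ a ∈ F, 2 ≤ a.length) (hirr : IsIrreducible F) :
    orderAt (genFun F) (perronRoot F : ℂ) = -1 := by
  have hneg := orderAt_genFun_neg hq hmin hlen
  obtain ⟨C, hC⟩ := exists_norm_genFun_mul_le hq hmin hlen hirr
  set θ : ℂ := (perronRoot F : ℂ) with hθ
  have hlin : AnalyticAt ℂ (fun z : ℂ => z - θ) θ := by fun_prop
  have hord : meromorphicOrderAt (fun z : ℂ => z - θ) θ = 1 := by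
    have := meromorphicOrderAt_zpow_id_sub_const (x := θ) (n := 1)
    rw [zpow_one] at this
    exact_mod_cast this
  have hmul := meromorphicOrderAt_mul hlin.meromorphicAt (meromorphicAt_toFun (genFun F) θ)
  rw [hord] at hmul
  have hnonneg : 0 ≤ meromorphicOrderAt ((fun z : ℂ => z - θ) * toFun (genFun F)) θ := by
    by_contra! hlt
    have h1 := tendsto_norm_atTop_iff_cobounded.2
      (tendsto_cobounded_of_meromorphicOrderAt_neg hlt)
    have h2 := h1.comp (tendsto_ofReal_nhdsGT _)
    have hid : Tendsto (fun x : ℝ => C * x) (𝓝[>] perronRoot F) (𝓝 (C * perronRoot F)) :=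
      (tendsto_const_nhds.mul tendsto_id).mono_left nhdsWithin_le_nhds
    refine not_tendsto_nhds_of_tendsto_atTop (tendsto_atTop_mono' _ ?_ h2) _ hid
    filter_upwards [self_mem_nhdsWithin] with x hx
    have hx' : perronRoot F < x := hx
    refine le_trans (le_of_eq ?_) (hC x hx')
    rw [Function.comp_apply, Pi.mul_apply, norm_mul, hθ, ← Complex.ofReal_sub, Complex.norm_real,
      Real.norm_of_nonneg (sub_nonneg.2 hx'.le), mul_comm]
  rw [hmul] at hnonneg
  exact withTop_eq_neg_one hneg hnonneg

end

end SFT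

/-! ### The theorem -/

theorem theorem4p1 (q : ℕ) (hq : 2 ≤ q) (F : Finset (List (Fin q)))
    (hmin : SFT.IsMinimal F) (hlen : ∀ a ∈ F, 2 ≤ a.length) :
    -- the rational generating function `G(z) = ∑ f(n) z ^ (-n)`
    (∃ G : RatFunc ℂ,
      (∀ z : ℂ, SFT.perronRoot F < ‖z‖ →
        HasSum (fun n : ℕ => (SFT.wordCount F n : ℂ) * (z⁻¹) ^ n) (SFT.toFun G z)) ∧
      AnalyticOnNhd ℂ (SFT.toFun G) {z : ℂ | SFT.perronRoot F < ‖z‖} ∧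
      SFT.orderAt G (SFT.perronRoot F : ℂ) < 0 ∧
      (SFT.IsIrreducible F → SFT.orderAt G (SFT.perronRoot F : ℂ) = -1)) ∧
    -- `r` is well defined, and the Perron root is the largest zero of `(z - q) + r(z)`
    (SFT.corrMatrix F).det ≠ 0 ∧
    IsGreatest {x : ℝ | 0 < SFT.orderAt (SFT.charFun F) (x : ℂ)} (SFT.perronRoot F) ∧
    (∀ z : ℂ, 0 < SFT.orderAt (SFT.charFun F) z → ‖z‖ ≤ SFT.perronRoot F) ∧
    (SFT.IsIrreducible F → SFT.orderAt (SFT.charFun F) (SFT.perronRoot F : ℂ) = 1) := by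
  have hq0 : 0 < q := by omega
  have hdet := SFT.det_corrPoly_ne_zero hmin hlen
  have hθ : ((SFT.perronRoot F : ℝ) : ℂ) ≠ 0 :=
    Complex.ofReal_ne_zero.2
      (zero_lt_one.trans_le (SFT.one_le_perronRoot hq0 hmin hlen)).ne'
  have hadd : ∀ z : ℂ, z ≠ 0 →
      SFT.orderAt (SFT.genFun F) z + SFT.orderAt (SFT.charFun F) z = 0 := fun z hz =>
    SFT.orderAt_add_orderAt (SFT.charNum_ne_zero hq0 hmin hlen) hdet
      (SFT.genFun_mul_charNum hq0 hmin hlen) (SFT.charFun_mul_det hdet) hz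
  have hanal : AnalyticOnNhd ℂ (SFT.toFun (SFT.genFun F)) {z : ℂ | SFT.perronRoot F < ‖z‖} :=
    fun z hz => (SFT.analyticAt_eval _ z).div (SFT.analyticAt_eval _ z)
      (SFT.denom_genFun_ne_zero hq0 hmin hlen hz)
  have hneg := SFT.orderAt_genFun_neg hq0 hmin hlen
  have hle : ∀ z : ℂ, 0 < SFT.orderAt (SFT.charFun F) z → ‖z‖ ≤ SFT.perronRoot F := by
    intro z hz
    by_contra! hlt
    have h1 : 0 ≤ SFT.orderAt (SFT.genFun F) z := (hanal z hlt).meromorphicOrderAt_nonneg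
    have h2 := hadd z (norm_pos_iff.1 (SFT.perronRoot_nonneg.trans_lt hlt))
    exact h1.not_gt ((SFT.withTop_pos_of_add_eq_zero h2).2 hz)
  refine ⟨⟨SFT.genFun F, fun z hz => ?_, hanal, hneg,
    SFT.orderAt_genFun_of_isIrreducible hq0 hmin hlen⟩, ?_, ⟨?_, fun x hx => ?_⟩, hle,
    fun hirr => ?_⟩
  · rw [SFT.toFun_genFun hq0 hmin hlen hz]
    exact SFT.hasSum_wordGen hq0 hmin hlen hz
  · rw [SFT.det_corrMatrix]
    exact RatFunc.algebraMap_ne_zero hdet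
  · exact (SFT.withTop_pos_of_add_eq_zero (hadd _ hθ)).1 hneg
  -- Maximality among real zeros is the modulus bound for complex zeros, applied to a real point.
  · refine (le_abs_self x).trans ?_
    rw [← Real.norm_eq_abs, ← Complex.norm_real]
    exact hle _ hx
  · have h := hadd _ hθ
    rw [SFT.orderAt_genFun_of_isIrreducible hq0 hmin hlen hirr] at h
    exact SFT.withTop_eq_one_of_neg_one_add h
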